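/- Lipschitz MAB problem. Let $X$ be a non-empty compact metric space with metric $L\le 1$. A problem instance assigns to every strategy $x\in X$ a payoff distribution on $[0,1]$ with mean $\mu(x)$ such that $|\mu(x)-\mu(y)|\le L(x,y)$ for all $x,y$. In each round an algorithm chooses a strategy $x$ as a function of the past strategies and payoffs, and then observes an independent sample from the distribution of $x$. Let $\mu^*=\sup_x\mu(x)$. The regret is $R_{\mathcal A}(t)=t\mu^*-W_{\mathcal A}(t)$, where $W_{\mathcal A}(t)$ is the expected total payoff in the first $t$ rounds, and $$\mathrm{RegretDim}(\mathcal A)=\sup_{\mathcal I}\ \inf\{d\ge 0:\ \exists t_0\ \forall t\ge t_0\ \ R_{\mathcal A}(t)\le t^{1-1/(d+2)}\},$$ the supremum being over all instances $\mathcal I$ on $X$. Fat decompositions. For $S\subseteq X$ let $\mathrm{COV}(S)$ be the infimum of all $d\in\mathbb R$ for which there is a constant $c$ such that, for all $r\in(0,1]$, $S$ can be covered by at most $c\,r^{-d}$ sets of diameter at most $r$. A $d^*$-fat decomposition $\mathcal D$ of depth $k$ is a sequence of closed sets $X=S_0\supseteq S_1\supseteq\dots\supseteq S_k\supseteq S_{k+1}=\emptyset$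 such that $\mathrm{COV}(S_k)\le d^*$ and $\mathrm{COV}(S_i\setminus U)\le d^*$ for all $0\le i\le k$ and all open $U\supseteq S_{i+1}$. A $\mathcal D$-covering oracle, given $i\in\{0,\dots,k\}$ and a finite list of open balls (centers and radii), either reports that the balls cover $S_i$ or returns a point of $S_i$ that is in none of them. The quota-based zooming algorithm $\mathcal A_{\mathcal D}$ with target dimension $d$. It uses $X$ and $\mathcal D$ only through the depth $k$ and a $\mathcal D$-covering oracle. It runs in phases $i=1,2,\dots$ of $T=2^i$ rounds, each started afresh. Within phase $i$, let $n_t(v)$ be the number of times $v$ was played before time $t$ in this phase, $\mu_t(v)$ the average payoff of these plays ($0$ if there are none), $r_t(v)=\sqrt{8i/(2+n_t(v))}$ and $I_t(v)=\mu_t(v)+2r_t(v)$. Put $\rho=T^{-1/(d+2)}$ and $C_\rho=(64\max(k,1)\log_2\frac1\rho)^{-1}$. * At the start of the phase the points of an initial net are activated: the $2^{-j}$-net of $X$ found greedily with the oracle, for the largest $j\le T$ for which this net has at most $\frac12T^{d/(d+2)}$ points. (If there is no such $j$, the first $\lfloor\frac12T^{d/(d+2)}\rfloor$ points of the greedy $1$-net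 are used.) All other active strategies lie in pools $P_0,\dots,P_k$, which are empty at first. * At the start of each round, if for some $m\in\{0,\dots,k\}$ with $|\{u\in P_m: r_t(u)\ge\rho\}|+1\le C_\rho\,\rho^{-d}$ the balls $B(v,r_t(v))$ around the active strategies $v$ do not cover $S_m$, then for the first such $m$ an uncovered strategy of $S_m$ returned by the oracle is activated and added to $P_m$. * Then an active strategy with maximal index $I_t$ is played, ties being broken by a fixed rule (if no strategy is active, some strategy returned by the oracle is played). Theorem. Let $\mathcal D$ be a $d^*$-fat decomposition of finite depth $k$ of $X$. Then for every $d>d^*$ the quota-based zooming algorithm $\mathcal A_{\mathcal D}$ with target dimension $d$, run with any $\mathcal D$-covering oracle, satisfies $$\mathrm{RegretDim}(\mathcal A_{\mathcal D})\le d.$$ -/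

import Mathlib

open Set MeasureTheory

namespace LipschitzMAB

/-! ### Covering dimension and fat decompositions -/

section Dimension

variable {X : Type*} [MetricSpace X]

/-- The smallest number of sets of diameter at most `r` that cover `S`. -/
noncomputable def coveringNumber (S : Set X) (r : ℝ) : ℕ∞ :=
  ⨅ F ∈ {F : Set (Set X) | (∀ A ∈ F, Metric.ediam A ≤ ENNReal.ofReal r) ∧ S ⊆ ⋃₀ F}, F.encard

/-- The covering dimension of `S`: the infimum of the `d` such that, for some constant `c`,
`S` is covered by `c r⁻ᵈ` sets of diameter at most `r` at every scale `0 < r ≤ 1`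
(all metric spaces below have diameter at most `1`). -/
noncomputable def covDim (S : Set X) : EReal :=
  sInf ((↑) '' {d : ℝ | ∃ c : ℝ, ∀ r : ℝ, 0 < r → r ≤ 1 →
    (coveringNumber S r : ENNReal) ≤ ENNReal.ofReal (c * r ^ (-d))})

variable (X) in
/-- A `d`-fat decomposition `X = S₀ ⊇ S₁ ⊇ ⋯ ⊇ S_k ⊇ S_{k+1} = ∅` of depth `k`. -/
structure FatDecomposition (d : ℝ) (k : ℕ) where
  S : Fin (k + 2) → Set X
  isClosed : ∀ i, IsClosed (S i)
  antitone : Antitone S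
  zero : S 0 = univ
  last : S (Fin.last (k + 1)) = ∅
  covDim_bottom : covDim (S (Fin.last k).castSucc) ≤ d
  covDim_diff : ∀ (i : Fin (k + 1)) (U : Set X), IsOpen U → S i.succ ⊆ U →
    covDim (S i.castSucc \ U) ≤ d

/-- An oracle for the decomposition `D`. A question consists of an index `i ≤ k` and of finitely
many open balls, given by centers and radii; the answer is `none` if the balls cover `S_i`, and
otherwise some point of `S_i` that none of the balls contains. -/
structure CoveringOracle {d : ℝ} {k : ℕ} (D : FatDecomposition X d k) where
  ask : Fin (k + 1) → List (X × ℝ) → Option X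
  covered : ∀ i bs, ask i bs = none → ∀ y ∈ D.S i.castSucc, ∃ b ∈ bs, y ∈ Metric.ball b.1 b.2
  uncovered : ∀ i bs x, ask i bs = some x →
    x ∈ D.S i.castSucc ∧ ∀ b ∈ bs, x ∉ Metric.ball b.1 b.2

open Classical in
instance {d : ℝ} {k : ℕ} (D : FatDecomposition X d k) : Nonempty (CoveringOracle D) :=
  ⟨{ ask := fun i bs =>
      if h : ∃ x, x ∈ D.S i.castSucc ∧ ∀ b ∈ bs, x ∉ Metric.ball b.1 b.2 then some h.choose
      else none
     covered := by
      intro i bs h y hy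
      by_contra hc
      have hex : ∃ x, x ∈ D.S i.castSucc ∧ ∀ b ∈ bs, x ∉ Metric.ball b.1 b.2 :=
        ⟨y, hy, fun b hb hyb => hc ⟨b, hb, hyb⟩⟩
      rw [dif_pos hex] at h
      cases h
     uncovered := by
      intro i bs x h
      split_ifs at h with hex
      cases h
      exact hex.choose_spec }⟩

end Dimension

/-! ### The Lipschitz multi-armed bandit problem -/

section Bandit

variable {X : Type*}

variable (X) in
/-- A (deterministic) bandit algorithm: a decision rule that maps the history of past
observations (strategy played, payoff received), most recent first, to the next strategy. -/
abbrev BanditAlgorithm := List (X × ℝ) → X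

variable (X) in
/-- A problem instance on the metric space `X`: payoff distributions on `[0,1]` whose
expectations satisfy the Lipschitz condition. -/
structure BanditInstance [MetricSpace X] where
  payoff : X → ProbabilityMeasure ℝ
  mem_Icc : ∀ x, ∀ᵐ r ∂(payoff x : Measure ℝ), r ∈ Icc (0 : ℝ) 1
  lipschitz : ∀ x y,
    |(∫ r, r ∂(payoff x : Measure ℝ)) - ∫ r, r ∂(payoff y : Measure ℝ)| ≤ dist x y

/-- The history after `t` rounds, where `ω (x, t)` is the payoff that strategy `x` yields
in round `t` if it is played then. -/
def history (A : BanditAlgorithm X) (ω : X × ℕ → ℝ) : ℕ → List (X × ℝ)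
  | 0 => []
  | t + 1 => (A (history A ω t), ω (A (history A ω t), t)) :: history A ω t

/-- The total payoff collected in the first `t` rounds. -/
def totalPayoff (A : BanditAlgorithm X) (t : ℕ) (ω : X × ℕ → ℝ) : ℝ :=
  ((history A ω t).map Prod.snd).sum

variable [MetricSpace X]

/-- The expected payoff `μ(x)` of a strategy. -/
noncomputable def BanditInstance.mean (I : BanditInstance X) (x : X) : ℝ :=
  ∫ r, r ∂(I.payoff x : Measure ℝ)

/-- The joint law of all payoffs: they are independent, and the payoff of `x` in any round has
the distribution `I.payoff x`. -/
noncomputable def BanditInstance.law (I : BanditInstance X) : Measure (X × ℕ → ℝ) :=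
  Measure.infinitePi fun p : X × ℕ => (I.payoff p.1 : Measure ℝ)

/-- The regret after `t` rounds: `t μ* - W(t)`, with `μ*` the supremum of the expected payoffs
and `W(t)` the expected total payoff. -/
noncomputable def regret (A : BanditAlgorithm X) (I : BanditInstance X) (t : ℕ) : ℝ :=
  t * (⨆ x, I.mean x) - ∫ ω, totalPayoff A t ω ∂I.law

/-- The regret dimension of `A` on the instance `I`. -/
noncomputable def regretDimOn (A : BanditAlgorithm X) (I : BanditInstance X) : EReal :=
  sInf ((↑) '' {d : ℝ | 0 ≤ d ∧
    ∃ t₀ : ℕ, ∀ t : ℕ, t₀ ≤ t → regret A I t ≤ (t : ℝ) ^ (1 - 1 / (d + 2))})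

/-- The regret dimension of `A`. -/
noncomputable def regretDim (A : BanditAlgorithm X) : EReal :=
  ⨆ I : BanditInstance X, regretDimOn A I

end Bandit

/-! ### The quota-based zooming algorithm

The algorithm only has access to the answers `ask` of a covering oracle; it sees neither the
metric nor the sets of the decomposition. Phase `i = 1, 2, …` has `T = 2 ^ i` rounds and starts
afresh: below, `h` is the history of the current phase, most recent round first. -/

section Algorithm

variable {X : Type*}

open Classical in
/-- The number of times `v` was played in this phase. -/
noncomputable def playCount (h : List (X × ℝ)) (v : X) : ℕ :=
  h.countP fun p => p.1 = v

open Classical in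
/-- The average payoff of `v` in this phase (`0` if `v` was not played). -/
noncomputable def avgPayoff (h : List (X × ℝ)) (v : X) : ℝ :=
  ((h.filter fun p => p.1 = v).map Prod.snd).sum / playCount h v

/-- The confidence radius. -/
noncomputable def confRadius (i : ℕ) (h : List (X × ℝ)) (v : X) : ℝ :=
  √(8 * i / (2 + playCount h v))

/-- The index. -/
noncomputable def index (i : ℕ) (h : List (X × ℝ)) (v : X) : ℝ :=
  avgPayoff h v + 2 * confRadius i h v

/-- The threshold `ρ = T ^ (-1 / (d + 2))`. -/
noncomputable def rho (d : ℝ) (i : ℕ) : ℝ := ((2 : ℝ) ^ i) ^ (-1 / (d + 2))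

/-- The quota `C_ρ ρ⁻ᵈ`, where `C_ρ = 1 / (64 k log (1 / ρ))`; depth `k = 0` is treated
as `k = 1`. -/
noncomputable def quota (d : ℝ) (k i : ℕ) : ℝ :=
  (64 * (max k 1 : ℕ) * Real.logb 2 (1 / rho d i))⁻¹ * rho d i ^ (-d)

variable {k : ℕ} (d : ℝ) (ask : Fin (k + 1) → List (X × ℝ) → Option X)

/-- Greedy construction of an `r`-net of `S₀ = X`: repeatedly add an uncovered point,
at most `n` times. -/
def greedyNet (r : ℝ) : ℕ → List X
  | 0 => []
  | n + 1 =>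
    match ask 0 ((greedyNet r n).map fun v => (v, r)) with
    | none => greedyNet r n
    | some x => x :: greedyNet r n

/-- The largest number of points allowed in the initial net, `⌊T ^ (d / (d + 2)) / 2⌋`. -/
noncomputable def netSize (i : ℕ) : ℕ := ⌊((2 : ℝ) ^ i) ^ (d / (d + 2)) / 2⌋₊

open Classical in
/-- The largest `j ≤ T` such that the greedy `2⁻ʲ`-net has at most `netSize d i` points.
(The search is cut off at `T` because on a finite space there is no largest `j`.) -/
noncomputable def netLevel (i : ℕ) : ℕ :=
  Nat.findGreatest
    (fun j => ask 0 ((greedyNet ask ((2 : ℝ)⁻¹ ^ j) (netSize d i)).map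
      fun v => (v, (2 : ℝ)⁻¹ ^ j)) = none) (2 ^ i)

/-- The net that is activated at the start of phase `i`. (If no level `j` is admissible, which can
only happen in the first few phases, these are just the first points of the greedy `1`-net.) -/
noncomputable def initialNet (i : ℕ) : List X :=
  greedyNet ask ((2 : ℝ)⁻¹ ^ netLevel d ask i) (netSize d i)

/-- The active strategies: the initial net and the pools `P₀, …, P_k`. -/
noncomputable def active (i : ℕ) (P : Fin (k + 1) → List X) : List X :=
  initialNet d ask i ++ (List.finRange (k + 1)).flatMap P

open Classical in
/-- There is room for a new strategy in the pool `l`: the number of `u ∈ l` with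
`r_t(u) ≥ ρ` stays within the quota if it is increased by one. (A new strategy has not been played,
so that its confidence radius is larger than `ρ`.) -/
def HasRoom (i : ℕ) (h : List (X × ℝ)) (l : List X) : Prop :=
  (l.countP fun u => rho d i ≤ confRadius i h u : ℝ) + 1 ≤ quota d k i

open Classical in
/-- The activation routine at the start of a round. If, for some `j` whose pool has room, some
strategy of `S_j` is not covered by the balls `B(v, r_t(v))` around the active `v`, then one such
strategy is added to the pool `P_j`. In a space of diameter at most `1` the routine need not be
repeated within a round: a strategy that has just been activated has confidence radius at least `2`
and covers everything. -/
noncomputable def activate (i : ℕ) (h : List (X × ℝ)) (P : Fin (k + 1) → List X) :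
    Fin (k + 1) → List X :=
  match (List.finRange (k + 1)).findSome? fun j =>
      if HasRoom (k := k) d i h (P j) then
        (ask j ((active d ask i P).map fun v => (v, confRadius i h v))).map fun x => (j, x)
      else none with
  | none => P
  | some (j, x) => Function.update P j (x :: P j)

/-- The pools after the activation routine of the current round. -/
noncomputable def pools (i : ℕ) : List (X × ℝ) → Fin (k + 1) → List X
  | [] => activate d ask i [] fun _ => []
  | p :: h => activate d ask i (p :: h) (pools i h)

open Classical in
/-- The strategy played in phase `i`: an active strategy of maximal index. (If there is none, which
can only happen in the first few phases, some strategy returned by the oracle is played.) -/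
noncomputable def phaseAlgorithm [Nonempty X] (i : ℕ) : BanditAlgorithm X := fun h =>
  (((active d ask i (pools d ask i h)).argmax (index i h)).or (ask 0 [])).getD
    (Classical.arbitrary X)

/-- The quota-based zooming algorithm with target dimension `d`. After `t` rounds, the current phase
is the `i` with `2 ^ i ≤ t + 2 < 2 ^ (i + 1)`, and `t + 2 - 2 ^ i` of its rounds are over. -/
noncomputable def quotaZooming [Nonempty X] : BanditAlgorithm X := fun h =>
  phaseAlgorithm d ask (Nat.log 2 (h.length + 2))
    (h.take (h.length + 2 - 2 ^ Nat.log 2 (h.length + 2)))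

end Algorithm

end LipschitzMAB

/-!
# The regret dimension of the quota-based zooming algorithm

The regret of an algorithm is the sum over the rounds of the expected gap `μ* - μ(x)` of the strategy
`x` played (`MeasurableAlgorithm.regret_eq_sum`), so it suffices to bound the sum of the gaps in a
phase of `T = 2 ^ i` rounds by `O(i T ^ γ)`, where `γ = 1 - 1 / (d + 2)`, up to an event of small
probability; sums over phases and the logarithms cost nothing in the dimension.

*Concentration.* The sum over all strategies `v` played of
`exp (lam * (S_v - n_v μ(v)) - lam ^ 2 * n_v / 8)`, where `S_v` is the total payoff of `v` and `n_v`
the number of its plays, grows by at most one per round in expectation, by Hoeffding's lemma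
(`lintegral_totalDeviation_cons_le`). Markov's inequality then shows that, except with probability
`O(1 / T)`, all averages in the phase are within the confidence radii of the means
(`law_exists_deviates_le`). Expectations over the next round are computed by resampling one entry of
the payoff table (`lintegral_law_resample`). Since `X` carries no useful `σ`-algebra, measurability
always refers to a fixed sequence of strategies played; a history has finitely many of these, and
the pools depend on nothing else.

*Deterministic part.* Let `S_m` be the deepest set of the decomposition that contains an optimal
strategy. By compactness the means on `S_{m+1}` are less than `μ* - δ` for some `δ > 0`, so the part
of `S_m` where the gap is at most `δ` has covering dimension at most `dstar` (`exists_gap`). Members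
of the pool `P_m` of radius at least `ρ` are `ρ`-separated. Those of gap at most `δ` number
`O(ρ⁻ᵉ)` for some `e < d`. Those of larger gap are rarely played, because the initial net is
eventually so fine that it contains better strategies; their radii thus stay bounded below, and
there are boundedly many (`countP_pool_le`). Hence in long phases `P_m` always has room and `S_m` is
covered whenever a strategy is chosen (`exists_active_dist_lt`). By optimism, the gap of each
strategy played is then at most three times its confidence radius (`mean_le_phaseAlgorithm`).

The sum of the radii at the times of play is at most `T ρ + 8 i K / ρ`, where `K` is the number of
strategies played (`radiusSum_le`). The bounds on the initial net and on the pools, and the fact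
that a strategy of radius below `ρ` was played at least `1 / ρ²` times, give
`K = O(T ^ (d / (d + 2)))` (`card_played_le`), and the sum is `O(i T ^ γ)`.
-/

namespace LipschitzMAB

/-! ### Measurability of histories -/

section Histories

variable {X : Type*}

/-- A symbolic history is a list of strategies, each with a random payoff; this is its value at the
payoff table `ω`. -/
def evalHistory (l : List (X × ((X × ℕ → ℝ) → ℝ))) (ω : X × ℕ → ℝ) : List (X × ℝ) :=
  l.map fun p => (p.1, p.2 ω)

/-- A function of histories that is measurable in the payoffs as long as the strategies played are
kept fixed. No `σ`-algebra on `X` is involved. -/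
def PathMeasurable {β : Type*} [MeasurableSpace β] (F : List (X × ℝ) → β) : Prop :=
  ∀ l : List (X × ((X × ℕ → ℝ) → ℝ)), (∀ p ∈ l, Measurable p.2) →
    Measurable fun ω => F (evalHistory l ω)

/-- An algorithm that, for any fixed sequence of strategies played so far, chooses among finitely
many strategies, in a way that is measurable in the payoffs. -/
def MeasurableAlgorithm (A : BanditAlgorithm X) : Prop :=
  ∀ l : List (X × ((X × ℕ → ℝ) → ℝ)), (∀ p ∈ l, Measurable p.2) →
    (∃ C : Finset X, ∀ ω, A (evalHistory l ω) ∈ C) ∧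
      ∀ x, MeasurableSet {ω | A (evalHistory l ω) = x}

theorem length_history (A : BanditAlgorithm X) (ω : X × ℕ → ℝ) (t : ℕ) :
    (history A ω t).length = t := by
  induction t with
  | zero => rfl
  | succ t ih => simp [history, ih]

/-- The history after `t` rounds does not depend on the payoffs of later rounds. -/
theorem history_congr (A : BanditAlgorithm X) {ω ω' : X × ℕ → ℝ} {t : ℕ}
    (h : ∀ x s, s < t → ω (x, s) = ω' (x, s)) : history A ω t = history A ω' t := by
  induction t with
  | zero => rfl
  | succ t ih =>
    have := ih fun x s hs => h x s (by omega)
    simp only [history, this, h _ t (Nat.lt_succ_self t)]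

open Classical in
theorem history_update (A : BanditAlgorithm X) (ω : X × ℕ → ℝ) (x : X) (t : ℕ) (r : ℝ) :
    history A (Function.update ω (x, t) r) t = history A ω t := by
  refine history_congr A fun y s hs => Function.update_of_ne ?_ _ _
  intro h
  have := congrArg Prod.snd h
  simp only at this
  omega

/-- The history of a measurable algorithm is piecewise symbolic, with finitely many measurable
pieces. -/
theorem MeasurableAlgorithm.exists_pieces {X : Type u} {A : BanditAlgorithm X}
    (hA : MeasurableAlgorithm A) (t : ℕ) :
    ∃ (ι : Type u) (_ : Finite ι) (l : ι → List (X × ((X × ℕ → ℝ) → ℝ)))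
      (E : ι → Set (X × ℕ → ℝ)),
      (∀ i, MeasurableSet (E i)) ∧ (∀ i, ∀ p ∈ l i, Measurable p.2) ∧
      (∀ i, ∀ ω ∈ E i, history A ω t = evalHistory (l i) ω) ∧ ∀ ω, ∃ i, ω ∈ E i := by
  induction t with
  | zero =>
    exact ⟨PUnit, inferInstance, fun _ => [], fun _ => univ, by simp, by simp,
      by simp [history, evalHistory], by simp⟩
  | succ t ih =>
    obtain ⟨ι, _, l, E, hE, hl, hH, hcov⟩ := ih
    choose C hC using fun i => (hA (l i) (hl i)).1
    -- Each piece is split according to the next strategy played.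
    refine ⟨Σ i, {x // x ∈ C i}, inferInstance,
      fun q => (q.2.1, fun ω => ω (q.2.1, t)) :: l q.1,
      fun q => E q.1 ∩ {ω | A (evalHistory (l q.1) ω) = q.2.1}, ?_, ?_, ?_, ?_⟩
    · exact fun q => (hE q.1).inter ((hA (l q.1) (hl q.1)).2 q.2.1)
    · intro q p hp
      rcases List.mem_cons.1 hp with rfl | hp
      · exact measurable_pi_apply _
      · exact hl q.1 p hp
    · rintro q ω ⟨h1, h2⟩
      rw [mem_ofPred_eq] at h2
      rw [history, hH q.1 ω h1, h2]
      rfl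
    · intro ω
      obtain ⟨i, hi⟩ := hcov ω
      exact ⟨⟨i, ⟨A (evalHistory (l i) ω), hC i ω⟩⟩, hi, rfl⟩

variable {A : BanditAlgorithm X}

theorem MeasurableAlgorithm.measurableSet_history (hA : MeasurableAlgorithm A) (t : ℕ)
    (P : List (X × ℝ) → Prop)
    (hP : ∀ l : List (X × ((X × ℕ → ℝ) → ℝ)), (∀ p ∈ l, Measurable p.2) →
      MeasurableSet {ω | P (evalHistory l ω)}) :
    MeasurableSet {ω | P (history A ω t)} := by
  obtain ⟨ι, _, l, E, hE, hl, hH, hcov⟩ := hA.exists_pieces t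
  have : {ω | P (history A ω t)} = ⋃ i, E i ∩ {ω | P (evalHistory (l i) ω)} := by
    ext ω
    simp only [mem_ofPred_eq, mem_iUnion, mem_inter_iff]
    constructor
    · intro h
      obtain ⟨i, hi⟩ := hcov ω
      exact ⟨i, hi, by rwa [← hH i ω hi]⟩
    · rintro ⟨i, hi, h⟩
      rwa [hH i ω hi]
  rw [this]
  exact MeasurableSet.iUnion fun i => (hE i).inter (hP _ (hl i))

/-- Reading off the entry `ω (x, t)` is not jointly measurable in `ω` and `x` when `X` is
uncountable. It is the finiteness of the set of possible strategies that makes path measurable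
functions of the history measurable. -/
theorem MeasurableAlgorithm.measurable_history {β : Type*} [MeasurableSpace β]
    (hA : MeasurableAlgorithm A) {F : List (X × ℝ) → β} (hF : PathMeasurable F) (t : ℕ) :
    Measurable fun ω => F (history A ω t) := fun s hs =>
  hA.measurableSet_history t (fun h => F h ∈ s) fun l hl => hF l hl hs

theorem MeasurableAlgorithm.measurableSet_play (hA : MeasurableAlgorithm A) (t : ℕ) (x : X) :
    MeasurableSet {ω | A (history A ω t) = x} :=
  hA.measurableSet_history t (fun h => A h = x) fun l hl => (hA l hl).2 x

theorem MeasurableAlgorithm.exists_finset_play (hA : MeasurableAlgorithm A) (t : ℕ) :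
    ∃ C : Finset X, ∀ ω, A (history A ω t) ∈ C := by
  classical
  obtain ⟨ι, _, l, E, -, hl, hH, hcov⟩ := hA.exists_pieces t
  have := Fintype.ofFinite ι
  choose C hC using fun i => (hA (l i) (hl i)).1
  refine ⟨Finset.univ.biUnion C, fun ω => ?_⟩
  obtain ⟨i, hi⟩ := hcov ω
  rw [hH i ω hi]
  exact Finset.mem_biUnion.2 ⟨i, Finset.mem_univ _, hC i ω⟩

theorem PathMeasurable.cons {β : Type*} [MeasurableSpace β] {F : List (X × ℝ) → β}
    (hF : PathMeasurable F) (hA : MeasurableAlgorithm A) (x : X) (t : ℕ) :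
    Measurable fun ω : X × ℕ → ℝ => F ((x, ω (x, t)) :: history A ω t) := by
  intro s hs
  have hpm : ∀ (l : List (X × ((X × ℕ → ℝ) → ℝ))), (∀ p ∈ l, Measurable p.2) →
      MeasurableSet {ω : X × ℕ → ℝ | F ((x, ω (x, t)) :: evalHistory l ω) ∈ s} := by
    intro l hl
    refine hF ((x, fun ω => ω (x, t)) :: l) ?_ hs
    intro p hp
    rcases List.mem_cons.1 hp with rfl | hp
    · exact measurable_pi_apply _
    · exact hl p hp
  obtain ⟨ι, _, l, E, hE, hl, hH, hcov⟩ := hA.exists_pieces t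
  have : (fun ω : X × ℕ → ℝ => F ((x, ω (x, t)) :: history A ω t)) ⁻¹' s =
      ⋃ i, E i ∩ {ω | F ((x, ω (x, t)) :: evalHistory (l i) ω) ∈ s} := by
    ext ω
    simp only [mem_preimage, mem_ofPred_eq, mem_iUnion, mem_inter_iff]
    constructor
    · intro h
      obtain ⟨i, hi⟩ := hcov ω
      exact ⟨i, hi, by rwa [← hH i ω hi]⟩
    · rintro ⟨i, hi, h⟩
      rwa [hH i ω hi]
  rw [this]
  exact MeasurableSet.iUnion fun i => (hE i).inter (hpm _ (hl i))

theorem MeasurableAlgorithm.measurable_payoff {A : BanditAlgorithm X} (hA : MeasurableAlgorithm A)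
    (t : ℕ) : Measurable fun ω : X × ℕ → ℝ => ω (A (history A ω t), t) := by
  have hF : PathMeasurable fun h : List (X × ℝ) => (h.head?.map Prod.snd).getD 0 := by
    intro l hl
    cases l with
    | nil => simp [evalHistory]
    | cons p l => simpa [evalHistory] using hl p (by simp)
  simpa [history] using hA.measurable_history hF (t + 1)

theorem totalPayoff_succ (A : BanditAlgorithm X) (t : ℕ) (ω : X × ℕ → ℝ) :
    totalPayoff A (t + 1) ω = ω (A (history A ω t), t) + totalPayoff A t ω := by
  simp [totalPayoff, history]

open Classical in
theorem measurable_update_prod (p : X × ℕ) :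
    Measurable fun q : (X × ℕ → ℝ) × ℝ => Function.update q.1 p q.2 := by
  refine measurable_pi_lambda _ fun i => ?_
  by_cases h : i = p
  · subst h; simpa using measurable_snd
  · simp only [Function.update_of_ne h]
    exact (measurable_pi_apply i).comp measurable_fst

end Histories

/-! ### Conditioning on the past -/

section Tower

variable {X : Type*} [MetricSpace X]

instance (I : BanditInstance X) : IsProbabilityMeasure I.law := by
  unfold BanditInstance.law; infer_instance

open Classical in
/-- Drawing one entry of the payoff table anew does not change its law. -/
theorem lintegral_law_resample (I : BanditInstance X) (p : X × ℕ)
    {f : (X × ℕ → ℝ) → ENNReal} (hf : Measurable f) :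
    ∫⁻ ω, f ω ∂I.law =
      ∫⁻ ω, ∫⁻ r, f (Function.update ω p r) ∂(I.payoff p.1 : Measure ℝ) ∂I.law := by
  have hupd := measurable_update_prod p
  -- Both laws assign the same probability to boxes, where `p` contributes one independent factor.
  have key : ((I.law).prod (I.payoff p.1 : Measure ℝ)).map
      (fun q : (X × ℕ → ℝ) × ℝ => Function.update q.1 p q.2) = I.law := by
    refine Measure.eq_infinitePi _ fun s t ht => ?_
    have hs : MeasurableSet (Set.pi (s : Set (X × ℕ)) t) :=
      MeasurableSet.pi s.countable_toSet fun i _ => ht i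
    rw [Measure.map_apply hupd hs]
    have hpre : (fun q : (X × ℕ → ℝ) × ℝ => Function.update q.1 p q.2) ⁻¹' Set.pi s t =
        (Set.pi (s.erase p : Finset (X × ℕ)) t) ×ˢ (if p ∈ s then t p else univ) := by
      ext ⟨ω, r⟩
      simp only [mem_preimage, Set.mem_pi, Finset.mem_coe, mem_prod, Finset.mem_erase]
      constructor
      · intro h
        refine ⟨fun i hi => by simpa [Function.update_of_ne hi.1] using h i hi.2, ?_⟩
        split_ifs with hp
        · simpa using h p hp
        · trivial
      · rintro ⟨h1, h2⟩ i hi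
        by_cases hip : i = p
        · subst hip; simpa [hi] using h2
        · simpa [Function.update_of_ne hip] using h1 i ⟨hip, hi⟩
    rw [hpre, Measure.prod_prod]
    unfold BanditInstance.law
    rw [Measure.infinitePi_pi _ fun i _ => ht i]
    split_ifs with hp
    · exact Finset.prod_erase_mul _ _ hp
    · rw [Finset.erase_eq_of_notMem hp]; simp
  conv_lhs => rw [← key]
  rw [lintegral_map hf hupd]
  exact lintegral_prod _ (hf.comp hupd).aemeasurable

/-- The tower property: the next payoff is a fresh sample from the distribution of the
strategy that the algorithm chooses on the basis of the past. -/
theorem lintegral_history_succ (I : BanditInstance X) {A : BanditAlgorithm X}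
    (hA : MeasurableAlgorithm A) {F : List (X × ℝ) → ENNReal} (hF : PathMeasurable F) (t : ℕ) :
    ∫⁻ ω, F (history A ω (t + 1)) ∂I.law =
      ∫⁻ ω, ∫⁻ r, F ((A (history A ω t), r) :: history A ω t)
        ∂(I.payoff (A (history A ω t)) : Measure ℝ) ∂I.law := by
  classical
  obtain ⟨C, hC⟩ := hA.exists_finset_play t
  -- The contribution of the event that `x` is played. This event does not depend on the payoffs of
  -- round `t`, so that the entry `(x, t)` can be resampled.
  let G : X → (X × ℕ → ℝ) → ENNReal := fun x =>
    {ω | A (history A ω t) = x}.indicator fun ω => F ((x, ω (x, t)) :: history A ω t)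
  have hG : ∀ x, Measurable (G x) := fun x =>
    (hF.cons hA x t).indicator (hA.measurableSet_play t x)
  have hGu : ∀ x ω r, G x (Function.update ω (x, t) r) =
      if A (history A ω t) = x then F ((x, r) :: history A ω t) else 0 := by
    intro x ω r
    simp only [G, indicator_apply, mem_ofPred_eq, history_update, Function.update_self]
  have h1 : ∀ ω, F (history A ω (t + 1)) = ∑ x ∈ C, G x ω := by
    intro ω
    rw [Finset.sum_eq_single (A (history A ω t))]
    · simp [G, history]
    · intro x _ hx
      simp [G, Ne.symm hx]
    · intro h; exact absurd (hC ω) h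
  have h2 : ∀ ω, ∫⁻ r, F ((A (history A ω t), r) :: history A ω t)
        ∂(I.payoff (A (history A ω t)) : Measure ℝ) =
      ∑ x ∈ C, ∫⁻ r, G x (Function.update ω (x, t) r) ∂(I.payoff x : Measure ℝ) := by
    intro ω
    rw [Finset.sum_eq_single (A (history A ω t))]
    · simp only [hGu, if_true]
    · intro x _ hx
      simp [hGu, Ne.symm hx]
    · intro h; exact absurd (hC ω) h
  simp_rw [h1, h2]
  rw [lintegral_finsetSum _ fun x _ => hG x, lintegral_finsetSum]
  · exact Finset.sum_congr rfl fun x _ => lintegral_law_resample I (x, t) (hG x)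
  · intro x _
    exact ((hG x).comp (measurable_update_prod (x, t))).lintegral_prod_right'

theorem BanditInstance.integrable_payoff (I : BanditInstance X) (x : X) :
    Integrable (fun r : ℝ => r) (I.payoff x : Measure ℝ) :=
  Integrable.of_mem_Icc 0 1 aemeasurable_id (I.mem_Icc x)

theorem BanditInstance.mean_mem_Icc (I : BanditInstance X) (x : X) : I.mean x ∈ Icc (0 : ℝ) 1 := by
  constructor
  · exact integral_nonneg_of_ae ((I.mem_Icc x).mono fun r hr => hr.1)
  · have := integral_mono_ae (I.integrable_payoff x) (integrable_const (1 : ℝ))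
      ((I.mem_Icc x).mono fun r hr => hr.2)
    simpa [BanditInstance.mean] using this

theorem MeasurableAlgorithm.ae_payoff_mem_Icc {A : BanditAlgorithm X}
    (hA : MeasurableAlgorithm A) (I : BanditInstance X) (t : ℕ) :
    ∀ᵐ ω ∂I.law, ω (A (history A ω t), t) ∈ Icc (0 : ℝ) 1 := by
  obtain ⟨C, hC⟩ := hA.exists_finset_play t
  have : ∀ᵐ ω ∂I.law, ∀ x ∈ C, ω (x, t) ∈ Icc (0 : ℝ) 1 := by
    refine (Finset.eventually_all C).2 fun x _ => ?_
    have hmp := measurePreserving_eval_infinitePi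
      (fun p : X × ℕ => (I.payoff p.1 : Measure ℝ)) (x, t)
    exact hmp.quasiMeasurePreserving.ae (I.mem_Icc x)
  filter_upwards [this] with ω hω using hω _ (hC ω)

theorem MeasurableAlgorithm.integrable_payoff {A : BanditAlgorithm X}
    (hA : MeasurableAlgorithm A) (I : BanditInstance X) (t : ℕ) :
    Integrable (fun ω : X × ℕ → ℝ => ω (A (history A ω t), t)) I.law :=
  Integrable.of_mem_Icc 0 1 (hA.measurable_payoff t).aemeasurable (hA.ae_payoff_mem_Icc I t)

theorem MeasurableAlgorithm.integrable_totalPayoff {A : BanditAlgorithm X}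
    (hA : MeasurableAlgorithm A) (I : BanditInstance X) (t : ℕ) :
    Integrable (totalPayoff A t) I.law := by
  induction t with
  | zero =>
    have : totalPayoff A 0 = fun _ => (0 : ℝ) := by ext ω; simp [totalPayoff, history]
    rw [this]; exact integrable_const _
  | succ t ih =>
    have : totalPayoff A (t + 1) =
        fun ω => ω (A (history A ω t), t) + totalPayoff A t ω := by
      ext ω; exact totalPayoff_succ A t ω
    rw [this]
    exact (hA.integrable_payoff I t).add ih

/-- A real function of the next strategy is a bounded measurable function of the payoffs. -/
theorem MeasurableAlgorithm.integrable_play {A : BanditAlgorithm X}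
    (hA : MeasurableAlgorithm A) (I : BanditInstance X) (t : ℕ) (g : X → ℝ) :
    Integrable (fun ω : X × ℕ → ℝ => g (A (history A ω t))) I.law := by
  classical
  obtain ⟨C, hC⟩ := hA.exists_finset_play t
  have : (fun ω : X × ℕ → ℝ => g (A (history A ω t))) =
      fun ω => ∑ x ∈ C, {ω | A (history A ω t) = x}.indicator (fun _ => g x) ω := by
    ext ω
    rw [Finset.sum_eq_single (A (history A ω t))]
    · simp
    · intro x _ hx
      simp [Ne.symm hx]
    · intro h; exact absurd (hC ω) h
  rw [this]
  exact integrable_finsetSum _ fun x _ =>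
    (integrable_const (g x)).indicator (hA.measurableSet_play t x)

theorem MeasurableAlgorithm.integral_payoff {A : BanditAlgorithm X}
    (hA : MeasurableAlgorithm A) (I : BanditInstance X) (t : ℕ) :
    ∫ ω, ω (A (history A ω t), t) ∂I.law = ∫ ω, I.mean (A (history A ω t)) ∂I.law := by
  have hF : PathMeasurable fun h : List (X × ℝ) =>
      ENNReal.ofReal ((h.head?.map Prod.snd).getD 0) := by
    intro l hl
    cases l with
    | nil => simp [evalHistory]
    | cons p l => simpa [evalHistory] using (hl p (by simp)).ennreal_ofReal
  have h := lintegral_history_succ I hA hF t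
  simp only [history, List.head?_cons, Option.map_some, Option.getD_some] at h
  rw [integral_eq_lintegral_of_nonneg_ae
      ((hA.ae_payoff_mem_Icc I t).mono fun ω hω => hω.1)
      (hA.measurable_payoff t).aestronglyMeasurable,
    integral_eq_lintegral_of_nonneg_ae
      (Filter.Eventually.of_forall fun ω => (I.mean_mem_Icc _).1)
      (hA.integrable_play I t _).aestronglyMeasurable, h]
  congr 1
  refine lintegral_congr fun ω => ?_
  rw [BanditInstance.mean, ofReal_integral_eq_lintegral_ofReal (I.integrable_payoff _)
    ((I.mem_Icc _).mono fun r hr => hr.1)]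

/-- The regret is the sum over the rounds of the expected gap between the best mean and the mean of
the strategy played. -/
theorem MeasurableAlgorithm.regret_eq_sum {A : BanditAlgorithm X}
    (hA : MeasurableAlgorithm A) (I : BanditInstance X) (t : ℕ) :
    regret A I t =
      ∑ s ∈ Finset.range t, ∫ ω, ((⨆ x, I.mean x) - I.mean (A (history A ω s))) ∂I.law := by
  have hW : ∫ ω, totalPayoff A t ω ∂I.law =
      ∑ s ∈ Finset.range t, ∫ ω, I.mean (A (history A ω s)) ∂I.law := by
    induction t with
    | zero => simp [totalPayoff, history]
    | succ t ih =>
      rw [Finset.sum_range_succ, ← ih, ← hA.integral_payoff I t,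
        ← integral_add (hA.integrable_totalPayoff I t) (hA.integrable_payoff I t)]
      exact integral_congr_ae (Filter.Eventually.of_forall fun ω => by
        simp only [totalPayoff_succ, add_comm])
  rw [regret, hW]
  simp_rw [integral_sub (integrable_const _) (hA.integrable_play I _ _)]
  simp

end Tower

/-! ### Measurability of the quota-based zooming algorithm -/

section ZoomingMeasurable

variable {X : Type*}

theorem playCount_cons_self (v : X) (r : ℝ) (h : List (X × ℝ)) :
    playCount ((v, r) :: h) v = playCount h v + 1 := by
  simp [playCount]

theorem playCount_cons_of_ne {u v : X} (huv : u ≠ v) (r : ℝ) (h : List (X × ℝ)) :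
    playCount ((u, r) :: h) v = playCount h v := by
  simp [playCount, huv]

theorem playCount_congr {h h' : List (X × ℝ)} (hh : h.map Prod.fst = h'.map Prod.fst) (v : X) :
    playCount h v = playCount h' v := by
  classical
  have key : ∀ h : List (X × ℝ), playCount h v = (h.map Prod.fst).countP fun x => x = v := by
    intro h
    rw [List.countP_map]
    unfold playCount
    congr
  rw [key, key, hh]

theorem confRadius_congr (i : ℕ) {h h' : List (X × ℝ)} (hh : h.map Prod.fst = h'.map Prod.fst) :
    confRadius i h = confRadius i h' := by
  ext v
  rw [confRadius, confRadius, playCount_congr hh]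

variable {k : ℕ} (d : ℝ) (ask : Fin (k + 1) → List (X × ℝ) → Option X)

theorem activate_congr (i : ℕ) {h h' : List (X × ℝ)} (hc : confRadius i h = confRadius i h')
    (P : Fin (k + 1) → List X) : activate d ask i h P = activate d ask i h' P := by
  have hr : HasRoom (k := k) d i h = HasRoom (k := k) d i h' := by
    unfold HasRoom
    rw [hc]
  unfold activate
  rw [hr, hc]

/-- The pools depend on the strategies played, but not on the payoffs. -/
theorem pools_congr (i : ℕ) {h h' : List (X × ℝ)} (hh : h.map Prod.fst = h'.map Prod.fst) :
    pools d ask i h = pools d ask i h' := by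
  induction h generalizing h' with
  | nil =>
    have : h' = [] := by simpa using hh.symm
    rw [this]
  | cons p h ih =>
    cases h' with
    | nil => simp at hh
    | cons p' h' =>
      have hh' : h.map Prod.fst = h'.map Prod.fst := by
        simp only [List.map_cons, List.cons.injEq] at hh; exact hh.2
      rw [pools, pools, ih hh', activate_congr d ask i (confRadius_congr i hh)]

theorem map_fst_evalHistory (l : List (X × ((X × ℕ → ℝ) → ℝ))) (ω : X × ℕ → ℝ) :
    (evalHistory l ω).map Prod.fst = l.map Prod.fst := by
  simp [evalHistory]

open Classical in
theorem pathMeasurable_sum_filter (v : X) :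
    PathMeasurable fun h : List (X × ℝ) => ((h.filter fun p => p.1 = v).map Prod.snd).sum := by
  intro l
  induction l with
  | nil => intro _; simp [evalHistory]
  | cons p l ih =>
    intro hl
    have h1 := hl p (by simp)
    have h2 := ih fun q hq => hl q (by simp [hq])
    by_cases hp : p.1 = v
    · simp only [evalHistory, List.map_cons, List.filter_cons, hp, decide_true, if_true,
        List.sum_cons]
      exact h1.add h2
    · simpa [evalHistory, List.filter_cons, hp] using h2

theorem pathMeasurable_index (i : ℕ) (v : X) :
    PathMeasurable fun h : List (X × ℝ) => index i h v := by
  intro l hl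
  have hc : ∀ ω, (evalHistory l ω).map Prod.fst = (evalHistory l 0).map Prod.fst := fun ω => by
    rw [map_fst_evalHistory, map_fst_evalHistory]
  have : (fun ω => index i (evalHistory l ω) v) = fun ω =>
      avgPayoff (evalHistory l ω) v + 2 * confRadius i (evalHistory l 0) v := by
    ext ω; rw [index, confRadius_congr i (hc ω)]
  rw [this]
  refine Measurable.add_const ?_ _
  unfold avgPayoff
  simp_rw [fun ω => playCount_congr (hc ω) v]
  exact (pathMeasurable_sum_filter v l hl).div_const _

theorem measurableSet_argmax {Ω : Type*} [MeasurableSpace Ω] {f : Ω → X → ℝ}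
    (hf : ∀ v, Measurable fun ω => f ω v) (L : List X) (o : Option X) :
    MeasurableSet {ω | L.argmax (f ω) = o} := by
  induction L using List.reverseRecOn generalizing o with
  | nil => simp
  | append_singleton L a ih =>
    have hlt : ∀ c, MeasurableSet {ω | f ω c < f ω a} := fun c =>
      measurableSet_lt (hf c) (hf a)
    have : {ω | (L ++ [a]).argmax (f ω) = o} =
        ({ω | L.argmax (f ω) = none} ∩ {_ω | some a = o}) ∪
        ⋃ c ∈ {c | c ∈ L}, {ω | L.argmax (f ω) = some c} ∩
          (({ω | f ω c < f ω a} ∩ {_ω | some a = o}) ∪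
            ({ω | f ω c < f ω a}ᶜ ∩ {_ω | some c = o})) := by
      ext ω
      simp only [List.argmax_concat, mem_ofPred_eq, mem_union, mem_inter_iff, mem_iUnion,
        mem_compl_iff, exists_prop]
      cases hL : L.argmax (f ω) with
      | none => simp
      | some c =>
        have hc : c ∈ L := List.argmax_mem hL
        simp only [reduceCtorEq, false_and, false_or, Option.some.injEq]
        split_ifs with hlt
        · constructor
          · intro h; exact ⟨c, hc, rfl, Or.inl ⟨hlt, h⟩⟩
          · rintro ⟨c', -, rfl, h | h⟩
            · exact h.2
            · exact absurd hlt h.1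
        · constructor
          · intro h; exact ⟨c, hc, rfl, Or.inr ⟨hlt, h⟩⟩
          · rintro ⟨c', -, rfl, h | h⟩
            · exact absurd h.1 hlt
            · exact h.2
    rw [this]
    refine ((ih none).inter (MeasurableSet.const _)).union ?_
    refine MeasurableSet.biUnion (List.finite_toSet L).countable fun c _ => ?_
    exact (ih _).inter (((hlt c).inter (MeasurableSet.const _)).union
      ((hlt c).compl.inter (MeasurableSet.const _)))

theorem measurableAlgorithm_phaseAlgorithm [Nonempty X] (i : ℕ) :
    MeasurableAlgorithm (phaseAlgorithm d ask i) := by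
  classical
  intro l hl
  have hc : ∀ ω, (evalHistory l ω).map Prod.fst = (evalHistory l 0).map Prod.fst := fun ω => by
    rw [map_fst_evalHistory, map_fst_evalHistory]
  let L := active d ask i (pools d ask i (evalHistory l 0))
  let g : Option X → X := fun o => (o.or (ask 0 [])).getD (Classical.arbitrary X)
  let M : (X × ℕ → ℝ) → Option X := fun ω => L.argmax (index i (evalHistory l ω))
  have hA : ∀ ω, phaseAlgorithm d ask i (evalHistory l ω) = g (M ω) := by
    intro ω
    simp only [phaseAlgorithm, pools_congr d ask i (hc ω), g, M, L]
  let s : Finset (Option X) := insert none (L.toFinset.image some)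
  have hM : ∀ ω, M ω ∈ s := by
    intro ω
    cases h : M ω with
    | none => simp [s]
    | some c =>
      have : c ∈ L := List.argmax_mem h
      simp [s, this]
  have hMm : ∀ o, MeasurableSet {ω | M ω = o} := fun o =>
    measurableSet_argmax (fun v => pathMeasurable_index i v l hl) L o
  refine ⟨⟨s.image g, fun ω => ?_⟩, fun x => ?_⟩
  · rw [hA]; exact Finset.mem_image_of_mem g (hM ω)
  · have : {ω | phaseAlgorithm d ask i (evalHistory l ω) = x} =
        ⋃ o ∈ (s : Set (Option X)), {ω | M ω = o} ∩ {_ω | g o = x} := by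
      ext ω
      simp only [hA, mem_ofPred_eq, mem_iUnion, mem_inter_iff, exists_prop]
      constructor
      · intro h; exact ⟨M ω, hM ω, rfl, h⟩
      · rintro ⟨o, -, rfl, h⟩; exact h
    rw [this]
    exact MeasurableSet.biUnion s.countable_toSet fun o _ =>
      (hMm o).inter (MeasurableSet.const _)

theorem measurableAlgorithm_quotaZooming [Nonempty X] :
    MeasurableAlgorithm (quotaZooming d ask) := by
  intro l hl
  have h := measurableAlgorithm_phaseAlgorithm d ask (Nat.log 2 (l.length + 2))
    (l.take (l.length + 2 - 2 ^ Nat.log 2 (l.length + 2)))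
    fun p hp => hl p (List.mem_of_mem_take hp)
  simpa only [quotaZooming, evalHistory, List.length_map, List.map_take] using h

end ZoomingMeasurable

/-! ### Concentration of the average payoffs -/

section Concentration

variable {X : Type*}

/-- The last `s` of the first `t₀ + s` rounds. -/
def recentHistory (A : BanditAlgorithm X) (ω : X × ℕ → ℝ) (t₀ s : ℕ) : List (X × ℝ) :=
  (history A ω (t₀ + s)).take s

theorem recentHistory_succ (A : BanditAlgorithm X) (ω : X × ℕ → ℝ) (t₀ s : ℕ) :
    recentHistory A ω t₀ (s + 1) =
      (A (history A ω (t₀ + s)), ω (A (history A ω (t₀ + s)), t₀ + s)) ::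
        recentHistory A ω t₀ s := rfl

open Classical in
theorem sum_playCount (h : List (X × ℝ)) :
    ∑ v ∈ (h.map Prod.fst).toFinset, playCount h v = h.length := by
  have : ∀ v, playCount h v = (h.map Prod.fst).count v := by
    intro v
    rw [List.count, List.countP_map]
    unfold playCount
    congr
  simp_rw [this]
  rw [List.sum_toFinset_count_eq_length, List.length_map]

open Classical in
theorem playCount_eq_zero_iff {h : List (X × ℝ)} {v : X} :
    playCount h v = 0 ↔ v ∉ h.map Prod.fst := by
  unfold playCount
  rw [List.countP_eq_zero]
  simp only [List.mem_map, not_exists, not_and, decide_eq_true_eq]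

theorem playCount_le_length (h : List (X × ℝ)) (v : X) : playCount h v ≤ h.length :=
  List.countP_le_length

variable [MetricSpace X]

open Classical in
/-- The exponential of the deviation of the payoffs of `v` from their mean, compensated so that
its expectation does not increase when `v` is played. -/
noncomputable def expDeviation (I : BanditInstance X) (lam : ℝ) (h : List (X × ℝ)) (v : X) : ℝ :=
  Real.exp (lam * (((h.filter fun p => p.1 = v).map Prod.snd).sum - playCount h v * I.mean v)
    - lam ^ 2 / 8 * playCount h v)

open Classical in
/-- The sum of the exponential deviations of all strategies played. -/
noncomputable def totalDeviation (I : BanditInstance X) (lam : ℝ) (h : List (X × ℝ)) : ℝ :=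
  ∑ v ∈ (h.map Prod.fst).toFinset, expDeviation I lam h v

theorem expDeviation_cons_self (I : BanditInstance X) (lam : ℝ) (h : List (X × ℝ)) (v : X)
    (r : ℝ) : expDeviation I lam ((v, r) :: h) v =
      expDeviation I lam h v * Real.exp (lam * (r - I.mean v) - lam ^ 2 / 8) := by
  unfold expDeviation
  rw [← Real.exp_add, playCount_cons_self]
  simp only [decide_true, List.filter_cons_of_pos, List.map_cons, List.sum_cons]
  push_cast
  congr 1
  ring

theorem expDeviation_cons_of_ne (I : BanditInstance X) (lam : ℝ) (h : List (X × ℝ)) {u v : X}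
    (huv : u ≠ v) (r : ℝ) : expDeviation I lam ((u, r) :: h) v = expDeviation I lam h v := by
  simp [expDeviation, playCount_cons_of_ne huv, huv]

open Classical in
theorem expDeviation_of_not_mem (I : BanditInstance X) (lam : ℝ) {h : List (X × ℝ)} {v : X}
    (hv : v ∉ h.map Prod.fst) : expDeviation I lam h v = 1 := by
  have h0 := playCount_eq_zero_iff.2 hv
  have : (h.filter fun p => decide (p.1 = v)) = [] := by
    rw [List.filter_eq_nil_iff]
    intro p hp
    simp only [decide_eq_true_eq]
    rintro rfl
    exact hv (List.mem_map_of_mem hp)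
  simp [expDeviation, h0, this]

theorem pathMeasurable_totalDeviation (I : BanditInstance X) (lam : ℝ) :
    PathMeasurable fun h => totalDeviation I lam h := by
  classical
  intro l hl
  have hc : ∀ ω, (evalHistory l ω).map Prod.fst = (evalHistory l 0).map Prod.fst := fun ω => by
    rw [map_fst_evalHistory, map_fst_evalHistory]
  unfold totalDeviation expDeviation
  simp_rw [map_fst_evalHistory, fun ω v => playCount_congr (hc ω) v]
  refine Finset.measurable_sum _ fun v _ => Real.measurable_exp.comp ?_
  exact (((pathMeasurable_sum_filter v l hl).sub_const _).const_mul lam).sub_const _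

/-- Hoeffding's lemma for one payoff. -/
theorem lintegral_exp_payoff_le (I : BanditInstance X) (lam : ℝ) (x : X) :
    ∫⁻ r, ENNReal.ofReal (Real.exp (lam * (r - I.mean x) - lam ^ 2 / 8))
      ∂(I.payoff x : Measure ℝ) ≤ 1 := by
  have hs := ProbabilityTheory.hasSubgaussianMGF_of_mem_Icc (X := fun r : ℝ => r)
    (μ := (I.payoff x : Measure ℝ)) aemeasurable_id (I.mem_Icc x)
  have hm := hs.mgf_le lam
  have hi := hs.integrable_exp_mul lam
  have heq : (fun r : ℝ => Real.exp (lam * (r - I.mean x) - lam ^ 2 / 8)) =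
      fun r => Real.exp (lam * (r - I.mean x)) * Real.exp (-(lam ^ 2 / 8)) := by
    ext r; rw [← Real.exp_add]; congr 1
  rw [← ofReal_integral_eq_lintegral_ofReal]
  · rw [heq, integral_mul_const]
    rw [ProbabilityTheory.mgf] at hm
    rw [← ENNReal.ofReal_one]
    apply ENNReal.ofReal_le_ofReal
    calc _ ≤ Real.exp ((((‖(1:ℝ) - 0‖₊ / 2) ^ 2 : NNReal) : ℝ) * lam ^ 2 / 2) *
          Real.exp (-(lam ^ 2 / 8)) := by gcongr; exact hm
      _ = 1 := by
        rw [← Real.exp_add, Real.exp_eq_one_iff]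
        push_cast
        simp
        ring
  · rw [heq]; exact hi.mul_const _
  · exact Filter.Eventually.of_forall fun r => (Real.exp_pos _).le

/-- One more round increases the conditional expectation of the total deviation by at most the
contribution `1` of a strategy that is played for the first time. -/
theorem lintegral_totalDeviation_cons_le (I : BanditInstance X) (lam : ℝ) (h : List (X × ℝ))
    (x : X) :
    ∫⁻ r, ENNReal.ofReal (totalDeviation I lam ((x, r) :: h)) ∂(I.payoff x : Measure ℝ) ≤
      ENNReal.ofReal (totalDeviation I lam h) + 1 := by
  classical
  set S := ((h.map Prod.fst).toFinset).erase x with hS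
  set a := ∑ v ∈ S, expDeviation I lam h v with ha
  have hpos : ∀ v, 0 ≤ expDeviation I lam h v := fun v => (Real.exp_pos _).le
  have ha0 : 0 ≤ a := Finset.sum_nonneg fun v _ => hpos v
  have hcons : ∀ r, totalDeviation I lam ((x, r) :: h) = a +
      expDeviation I lam h x * Real.exp (lam * (r - I.mean x) - lam ^ 2 / 8) := by
    intro r
    have : (((x, r) :: h).map Prod.fst).toFinset = insert x S := by
      ext v
      by_cases hv : v = x <;> simp [hS, hv]
    rw [totalDeviation, this, Finset.sum_insert (by simp [hS]), expDeviation_cons_self, add_comm,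
      ha]
    congr 1
    refine Finset.sum_congr rfl fun v hv => expDeviation_cons_of_ne _ _ _ ?_ _
    rintro rfl
    simp [hS] at hv
  have hle : a + expDeviation I lam h x ≤ totalDeviation I lam h + 1 := by
    by_cases hx : x ∈ h.map Prod.fst
    · have : totalDeviation I lam h = a + expDeviation I lam h x := by
        rw [totalDeviation, ha, hS, Finset.sum_erase_add _ _ (by simpa using hx)]
      linarith
    · have : totalDeviation I lam h = a := by
        rw [totalDeviation, ha, hS, Finset.erase_eq_of_notMem (by simpa using hx)]
      rw [expDeviation_of_not_mem I lam hx]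
      linarith
  simp_rw [hcons]
  have hofr : ∀ r : ℝ, ENNReal.ofReal (a +
      expDeviation I lam h x * Real.exp (lam * (r - I.mean x) - lam ^ 2 / 8)) =
      ENNReal.ofReal a + ENNReal.ofReal (expDeviation I lam h x) *
        ENNReal.ofReal (Real.exp (lam * (r - I.mean x) - lam ^ 2 / 8)) := by
    intro r
    rw [ENNReal.ofReal_add ha0 (mul_nonneg (hpos x) (Real.exp_pos _).le),
      ENNReal.ofReal_mul (hpos x)]
  simp_rw [hofr]
  rw [lintegral_add_left measurable_const,
    lintegral_const_mul' _ _ ENNReal.ofReal_ne_top, lintegral_const]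
  calc _ ≤ ENNReal.ofReal a * 1 + ENNReal.ofReal (expDeviation I lam h x) * 1 := by
        gcongr
        · simp
        · exact lintegral_exp_payoff_le I lam x
    _ = ENNReal.ofReal (a + expDeviation I lam h x) := by
        rw [mul_one, mul_one, ENNReal.ofReal_add ha0 (hpos x)]
    _ ≤ ENNReal.ofReal (totalDeviation I lam h + 1) := ENNReal.ofReal_le_ofReal hle
    _ ≤ _ := by
        refine ENNReal.ofReal_add_le.trans ?_
        simp

/-- The total deviation plays the role of an exponential supermartingale for all strategies at
once, so that no union bound over strategies is needed. -/
theorem lintegral_totalDeviation_le (I : BanditInstance X) {A : BanditAlgorithm X}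
    (hA : MeasurableAlgorithm A) (lam : ℝ) (t₀ s : ℕ) :
    ∫⁻ ω, ENNReal.ofReal (totalDeviation I lam (recentHistory A ω t₀ s)) ∂I.law ≤ s := by
  induction s with
  | zero => simp [recentHistory, totalDeviation]
  | succ s ih =>
    have hF : PathMeasurable fun h : List (X × ℝ) =>
        ENNReal.ofReal (totalDeviation I lam (h.take (s + 1))) := by
      intro l hl
      have := pathMeasurable_totalDeviation I lam (l.take (s + 1))
        fun p hp => hl p (List.mem_of_mem_take hp)
      simpa only [evalHistory, List.map_take] using this.ennreal_ofReal
    have h := lintegral_history_succ I hA hF (t₀ + s)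
    calc _ = _ := h
      _ ≤ ∫⁻ ω, (ENNReal.ofReal (totalDeviation I lam (recentHistory A ω t₀ s)) + 1) ∂I.law :=
        lintegral_mono fun ω => by
          simpa [recentHistory] using
            lintegral_totalDeviation_cons_le I lam (recentHistory A ω t₀ s)
              (A (history A ω (t₀ + s)))
      _ ≤ _ := by
        rw [lintegral_add_right _ measurable_const]
        push_cast
        gcongr
        simp

/-- Some strategy has an average payoff in `h` that differs from its mean by more than the
confidence radius. -/
def Deviates (I : BanditInstance X) (i : ℕ) (h : List (X × ℝ)) : Prop :=
  ∃ v, confRadius i h v < |avgPayoff h v - I.mean v|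

/-- If some average is off by more than the radius, then the total deviation is large for
`lam = ± 4 r`, where `r` is the radius after `n` plays. -/
theorem Deviates.exists_totalDeviation_ge {I : BanditInstance X} {i : ℕ} (hi : 1 ≤ i)
    {h : List (X × ℝ)} (hd : Deviates I i h) :
    ∃ n ∈ Finset.range h.length, ∃ b ∈ ({4, -4} : Finset ℝ),
      Real.exp (16 * i / 3) ≤ totalDeviation I (b * √(8 * i / (2 + (n + 1 : ℕ)))) h := by
  classical
  obtain ⟨v, hv⟩ := hd
  have hi1 : (1 : ℝ) ≤ i := by exact_mod_cast hi
  -- A strategy that was not played has average `0` and a radius of at least `1`.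
  by_cases h0 : playCount h v = 0
  · exfalso
    have hm := I.mean_mem_Icc v
    have : (1 : ℝ) ≤ confRadius i h v := by
      rw [confRadius, h0]
      refine Real.one_le_sqrt.2 ?_
      push_cast
      linarith
    rw [avgPayoff, h0] at hv
    simp only [Nat.cast_zero, div_zero, zero_sub, abs_neg, abs_of_nonneg hm.1] at hv
    linarith [hm.2]
  obtain ⟨n, hn⟩ := Nat.exists_eq_succ_of_ne_zero h0
  have hmem : v ∈ (h.map Prod.fst).toFinset := by
    rw [List.mem_toFinset]
    by_contra hc
    exact h0 (playCount_eq_zero_iff.2 hc)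
  have hlen := playCount_le_length h v
  set N : ℝ := ((n + 1 : ℕ) : ℝ) with hN
  have hN1 : 1 ≤ N := by rw [hN]; push_cast; linarith [n.cast_nonneg (α := ℝ)]
  set r := √(8 * i / (2 + N)) with hr
  have hr0 : 0 ≤ r := Real.sqrt_nonneg _
  have hr2 : r ^ 2 = 8 * i / (2 + N) := Real.sq_sqrt (by positivity)
  set S := ((h.filter fun p => decide (p.1 = v)).map Prod.snd).sum with hSdef
  have hcount : (playCount h v : ℝ) = N := by rw [hn]
  have hv' : r * N < |S - N * I.mean v| := by
    rw [confRadius, avgPayoff, hcount, ← hr, ← hSdef] at hv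
    have : S - N * I.mean v = (S / N - I.mean v) * N := by field_simp
    rw [this, abs_mul, abs_of_pos (by linarith : 0 < N)]
    gcongr
  have hbig : 16 * (i : ℝ) / 3 ≤ 2 * N * r ^ 2 := by
    rw [hr2, div_le_iff₀ (by norm_num), mul_div_assoc', div_mul_eq_mul_div,
      le_div_iff₀ (by linarith)]
    nlinarith
  have hle : ∀ lam, expDeviation I lam h v ≤ totalDeviation I lam h := fun lam =>
    Finset.single_le_sum (f := fun v => expDeviation I lam h v)
      (fun v _ => (Real.exp_pos _).le) hmem
  refine ⟨n, Finset.mem_range.2 (by omega), ?_⟩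
  rcases lt_abs.1 hv' with hp | hp
  · refine ⟨4, by simp, le_trans ?_ (hle _)⟩
    rw [expDeviation, hcount, Real.exp_le_exp, ← hSdef]
    nlinarith
  · refine ⟨-4, by simp, le_trans ?_ (hle _)⟩
    rw [expDeviation, hcount, Real.exp_le_exp, ← hSdef]
    nlinarith

/-- Markov's inequality for the total deviation, and a union bound over the number of plays and the
sign of the deviation. -/
theorem law_deviates_le (I : BanditInstance X) {A : BanditAlgorithm X}
    (hA : MeasurableAlgorithm A) {i : ℕ} (hi : 1 ≤ i) (t₀ s : ℕ) :
    I.law {ω | Deviates I i (recentHistory A ω t₀ s)} ≤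
      ENNReal.ofReal (2 * s ^ 2 / Real.exp (16 * i / 3)) := by
  set K := Real.exp (16 * i / 3) with hK
  have hK0 : 0 < K := Real.exp_pos _
  have hlen : ∀ ω, (recentHistory A ω t₀ s).length = s := by
    intro ω; simp [recentHistory, length_history]
  have hone : ∀ lam, I.law {ω | ENNReal.ofReal K ≤
      ENNReal.ofReal (totalDeviation I lam (recentHistory A ω t₀ s))} ≤
      ENNReal.ofReal (s / K) := by
    intro lam
    refine (meas_ge_le_lintegral_div ?_ (by simpa using hK0) ENNReal.ofReal_ne_top).trans ?_
    · have := hA.measurable_history (F := fun h : List (X × ℝ) =>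
        ENNReal.ofReal (totalDeviation I lam (h.take s))) ?_ (t₀ + s)
      · exact this.aemeasurable
      intro l hl
      have := pathMeasurable_totalDeviation I lam (l.take s)
        fun p hp => hl p (List.mem_of_mem_take hp)
      simpa only [evalHistory, List.map_take] using this.ennreal_ofReal
    · rw [ENNReal.ofReal_div_of_pos hK0, ENNReal.ofReal_natCast]
      gcongr
      exact lintegral_totalDeviation_le I hA lam t₀ s
  have hsub : {ω | Deviates I i (recentHistory A ω t₀ s)} ⊆
      ⋃ n ∈ Finset.range s, ⋃ b ∈ ({4, -4} : Finset ℝ), {ω | ENNReal.ofReal K ≤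
        ENNReal.ofReal (totalDeviation I (b * √(8 * i / (2 + (n + 1 : ℕ))))
          (recentHistory A ω t₀ s))} := by
    intro ω hω
    obtain ⟨n, hn, b, hb, h⟩ := Deviates.exists_totalDeviation_ge hi hω
    rw [hlen] at hn
    simp only [mem_iUnion]
    exact ⟨n, hn, b, hb, ENNReal.ofReal_le_ofReal h⟩
  calc _ ≤ _ := measure_mono hsub
    _ ≤ ∑ n ∈ Finset.range s, ∑ b ∈ ({4, -4} : Finset ℝ), ENNReal.ofReal (s / K) := by
      refine (measure_biUnion_finset_le _ _).trans (Finset.sum_le_sum fun n _ => ?_)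
      exact (measure_biUnion_finset_le _ _).trans (Finset.sum_le_sum fun b _ => hone _)
    _ = _ := by
      rw [Finset.sum_const, Finset.sum_const, Finset.card_range,
        Finset.card_pair (by norm_num : (4 : ℝ) ≠ -4), ← ENNReal.ofReal_nsmul,
        ← ENNReal.ofReal_nsmul]
      congr 1
      simp only [nsmul_eq_mul]
      push_cast
      ring

/-- In a phase of `2 ^ i` rounds, all averages stay within their confidence radii, except with
probability `O(2⁻ⁱ)`. -/
theorem law_exists_deviates_le (I : BanditInstance X) {A : BanditAlgorithm X}
    (hA : MeasurableAlgorithm A) {i : ℕ} (hi : 1 ≤ i) (t₀ : ℕ) :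
    I.law {ω | ∃ s ≤ 2 ^ i, Deviates I i (recentHistory A ω t₀ s)} ≤
      ENNReal.ofReal (4 / 2 ^ i) := by
  have hsub : {ω | ∃ s ≤ 2 ^ i, Deviates I i (recentHistory A ω t₀ s)} =
      ⋃ s ∈ Finset.range (2 ^ i + 1), {ω | Deviates I i (recentHistory A ω t₀ s)} := by
    ext ω
    simp
  set K := Real.exp (16 * i / 3) with hK
  -- Together, the union bound over rounds and numbers of plays and the growth of the total deviation
  -- cost a factor of order `8 ^ i`.
  have hK16 : (16 : ℝ) ^ i ≤ K := by
    have h16 : (16 : ℝ) ≤ Real.exp (16 / 3) := by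
      have h1 : (2 : ℝ) ≤ Real.exp 1 := by linarith [Real.add_one_le_exp (1 : ℝ)]
      calc (16 : ℝ) = 2 ^ 4 := by norm_num
        _ ≤ Real.exp 1 ^ 4 := by gcongr
        _ = Real.exp 4 := by rw [← Real.exp_nat_mul]; norm_num
        _ ≤ _ := Real.exp_le_exp.2 (by norm_num)
    calc (16 : ℝ) ^ i ≤ Real.exp (16 / 3) ^ i := by gcongr
      _ = K := by rw [← Real.exp_nat_mul, hK]; congr 1; ring
  rw [hsub]
  calc _ ≤ ∑ s ∈ Finset.range (2 ^ i + 1), ENNReal.ofReal (2 * (2 ^ i) ^ 2 / K) := by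
        refine (measure_biUnion_finset_le _ _).trans (Finset.sum_le_sum fun s hs => ?_)
        refine (law_deviates_le I hA hi t₀ s).trans (ENNReal.ofReal_le_ofReal ?_)
        have : (s : ℝ) ≤ 2 ^ i := by
          exact_mod_cast Nat.lt_succ_iff.1 (Finset.mem_range.1 hs)
        gcongr
    _ ≤ _ := by
        rw [Finset.sum_const, Finset.card_range, ← ENNReal.ofReal_nsmul]
        apply ENNReal.ofReal_le_ofReal
        rw [nsmul_eq_mul]
        push_cast
        have h2 : (1 : ℝ) ≤ 2 ^ i := one_le_pow₀ (by norm_num)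
        have h16 : ((2 : ℝ) ^ i) ^ 4 = 16 ^ i := by
          rw [← pow_mul, mul_comm, pow_mul]; norm_num
        rw [mul_div_assoc', div_le_div_iff₀ (Real.exp_pos _) (by positivity)]
        calc _ = 2 * ((2 : ℝ) ^ i + 1) * (2 ^ i) ^ 3 := by ring
          _ ≤ 2 * ((2 : ℝ) ^ i + 2 ^ i) * (2 ^ i) ^ 3 := by gcongr
          _ = 4 * ((2 : ℝ) ^ i) ^ 4 := by ring
          _ ≤ _ := by rw [h16]; gcongr

end Concentration

/-! ### Separated sets and covering numbers -/

section Separation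

variable {X : Type*} [MetricSpace X]

/-- A set of diameter less than `ε` contains at most one element of an `ε`-separated list. -/
theorem length_le_encard_of_separated {S : Set X} {F : Set (Set X)} {ε : ℝ} (hε : 0 < ε)
    (hF : ∀ A ∈ F, ∀ x ∈ A, ∀ y ∈ A, dist x y < ε) (hS : S ⊆ ⋃₀ F) {l : List X}
    (hl : ∀ x ∈ l, x ∈ S) (hsep : l.Pairwise fun x y => ε ≤ dist x y) :
    (l.length : ℕ∞) ≤ F.encard := by
  classical
  have hnd : l.Nodup := by
    refine hsep.imp fun {x y} h => ?_
    rintro rfl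
    rw [dist_self] at h
    linarith
  have : Std.Symm fun x y : X => ε ≤ dist x y := ⟨fun x y h => by rwa [dist_comm]⟩
  have hsep' : ∀ x ∈ l, ∀ y ∈ l, x ≠ y → ε ≤ dist x y :=
    fun x hx y hy hxy => hsep.forall hx hy hxy
  have hex : ∀ x : X, ∃ A : Set X, x ∈ l → A ∈ F ∧ x ∈ A := by
    intro x
    by_cases hx : x ∈ l
    · obtain ⟨A, hA, hxA⟩ := hS (hl x hx)
      exact ⟨A, fun _ => ⟨hA, hxA⟩⟩
    · exact ⟨∅, fun h => absurd h hx⟩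
  choose f hf using hex
  have hcard : ((l.toFinset : Set X)).encard = l.length := by
    rw [Set.encard_coe_eq_coe_finsetCard, List.toFinset_card_of_nodup hnd]
  rw [← hcard]
  refine Set.encard_le_encard_of_injOn (f := f) ?_ ?_
  · intro x hx
    exact (hf x (by simpa using hx)).1
  · intro x hx y hy hxy
    have hx' : x ∈ l := by simpa using hx
    have hy' : y ∈ l := by simpa using hy
    by_contra hne
    have h1 := hsep' x hx' y hy' hne
    have h2 := hF (f x) (hf x hx').1 x (hf x hx').2 y (hxy ▸ (hf y hy').2)
    linarith

theorem length_le_coveringNumber {S : Set X} {r ε : ℝ} (hr : 0 ≤ r) (hrε : r < ε) {l : List X}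
    (hl : ∀ x ∈ l, x ∈ S) (hsep : l.Pairwise fun x y => ε ≤ dist x y) :
    (l.length : ℕ∞) ≤ coveringNumber S r := by
  refine le_iInf₂ fun F hF => ?_
  refine length_le_encard_of_separated (hr.trans_lt hrε) (fun A hA x hx y hy => ?_) hF.2 hl hsep
  refine lt_of_le_of_lt ?_ hrε
  have h := (Metric.edist_le_ediam_of_mem hx hy).trans (hF.1 A hA)
  rw [edist_dist] at h
  exact (ENNReal.ofReal_le_ofReal_iff hr).1 h

theorem length_le_of_coveringNumber_le {S : Set X} {c e r ε : ℝ} (hr : 0 < r) (hrε : r < ε)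
    (h : (coveringNumber S r : ENNReal) ≤ ENNReal.ofReal (c * r ^ (-e))) {l : List X}
    (hl : ∀ x ∈ l, x ∈ S) (hsep : l.Pairwise fun x y => ε ≤ dist x y) :
    (l.length : ℝ) ≤ max (c * r ^ (-e)) 0 := by
  have h1 : ((l.length : ℕ∞) : ENNReal) ≤ (coveringNumber S r : ENNReal) :=
    ENat.toENNReal_le.2 (length_le_coveringNumber hr.le hrε hl hsep)
  have h2 := h1.trans h
  rw [ENat.toENNReal_coe] at h2
  have h3 : ENNReal.ofReal (l.length : ℝ) ≤ ENNReal.ofReal (c * r ^ (-e)) := by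
    rwa [ENNReal.ofReal_natCast]
  rcases le_total 0 (c * r ^ (-e)) with h0 | h0
  · exact ((ENNReal.ofReal_le_ofReal_iff h0).1 h3).trans (le_max_left _ _)
  · rw [ENNReal.ofReal_of_nonpos h0, nonpos_iff_eq_zero, ENNReal.ofReal_eq_zero] at h3
    exact h3.trans (le_max_right _ _)

theorem exists_separated_length_le [CompactSpace X] {ε : ℝ} (hε : 0 < ε) :
    ∃ M : ℕ, ∀ l : List X, (l.Pairwise fun x y => ε ≤ dist x y) → l.length ≤ M := by
  obtain ⟨t, -, ht, hcov⟩ :=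
    finite_cover_balls_of_compact (X := X) isCompact_univ (half_pos hε)
  have hfin : ((fun x => Metric.ball x (ε / 2)) '' t).Finite := ht.image _
  refine ⟨((fun x => Metric.ball x (ε / 2)) '' t).ncard, fun l hl => ?_⟩
  have h := length_le_encard_of_separated (S := univ)
    (F := (fun x => Metric.ball x (ε / 2)) '' t) hε ?_ ?_ (fun x _ => mem_univ x) hl
  · rw [← hfin.cast_ncard_eq] at h
    exact_mod_cast h
  · rintro A ⟨z, -, rfl⟩ x hx y hy
    have := dist_triangle_right x y z
    rw [Metric.mem_ball] at hx hy
    linarith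
  · rw [sUnion_image]
    exact hcov

/-- Only the empty set has negative covering dimension. -/
theorem covDim_nonneg {S : Set X} (hS : S.Nonempty) : 0 ≤ covDim S := by
  refine le_sInf ?_
  rintro _ ⟨e, ⟨c, hc⟩, rfl⟩
  rw [← EReal.coe_zero, EReal.coe_le_coe_iff]
  by_contra he
  push Not at he
  obtain ⟨x, hx⟩ := hS
  have h1 : ∀ r : ℝ, 0 < r → r ≤ 1 → 1 ≤ max (c * r ^ (-e)) 0 := by
    intro r hr hr1
    have := length_le_of_coveringNumber_le (ε := r + 1) hr (by linarith) (hc r hr hr1)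
      (l := [x]) (by simpa using hx) (List.pairwise_singleton _ _)
    simpa using this
  have hlim : Filter.Tendsto (fun r : ℝ => max (c * r ^ (-e)) 0) (nhdsWithin 0 (Ioi 0))
      (nhds (max (c * 0 ^ (-e)) 0)) :=
    (((Real.continuousAt_rpow_const 0 (-e) (Or.inr (by linarith))).tendsto.mono_left
      nhdsWithin_le_nhds).const_mul c).max tendsto_const_nhds
  have hev : ∀ᶠ r : ℝ in nhdsWithin 0 (Ioi 0), 1 ≤ max (c * r ^ (-e)) 0 := by
    filter_upwards [Ioo_mem_nhdsGT (zero_lt_one' ℝ)] with r hr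
    exact h1 r hr.1 hr.2.le
  have := ge_of_tendsto hlim hev
  rw [Real.zero_rpow (by linarith)] at this
  norm_num at this

end Separation

/-! ### The initial net -/

section Net

variable {X : Type*} [MetricSpace X] {k : ℕ} {dstar : ℝ} {D : FatDecomposition X dstar k}
  (O : CoveringOracle D)

theorem length_greedyNet_le {X : Type*} {k : ℕ} (ask : Fin (k + 1) → List (X × ℝ) → Option X)
    (r : ℝ) (n : ℕ) : (greedyNet ask r n).length ≤ n := by
  induction n with
  | zero => simp [greedyNet]
  | succ n ih =>
    rw [greedyNet]
    split
    · omega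
    · simpa using ih

/-- The greedy construction stops early only if the net is complete. -/
theorem greedyNet_complete_or_length_eq {X : Type*} {k : ℕ}
    (ask : Fin (k + 1) → List (X × ℝ) → Option X) (r : ℝ) (n : ℕ) :
    ask 0 ((greedyNet ask r n).map fun v => (v, r)) = none ∨ (greedyNet ask r n).length = n := by
  induction n with
  | zero => simp [greedyNet]
  | succ n ih =>
    rw [greedyNet]
    split
    · left; assumption
    · rename_i x hx
      right
      rcases ih with h | h
      · rw [h] at hx; cases hx
      · simpa using h

theorem greedyNet_separated (r : ℝ) (n : ℕ) :
    (greedyNet O.ask r n).Pairwise fun x y => r ≤ dist x y := by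
  induction n with
  | zero => simp [greedyNet]
  | succ n ih =>
    rw [greedyNet]
    split
    · exact ih
    · rename_i x hx
      refine List.pairwise_cons.2 ⟨fun v hv => ?_, ih⟩
      have := (O.uncovered _ _ _ hx).2 (v, r) (List.mem_map.2 ⟨v, hv, rfl⟩)
      simpa [Metric.mem_ball] using this

theorem exists_mem_dist_lt {j : Fin (k + 1)} {L : List X} {r : X → ℝ}
    (h : O.ask j (L.map fun v => (v, r v)) = none) {x : X} (hx : x ∈ D.S j.castSucc) :
    ∃ v ∈ L, dist x v < r v := by
  obtain ⟨b, hb, hxb⟩ := O.covered _ _ h x hx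
  obtain ⟨v, hv, rfl⟩ := List.mem_map.1 hb
  exact ⟨v, hv, hxb⟩

/-- As the phases get longer, the initial nets become arbitrarily fine. -/
theorem eventually_initialNet_dist_lt [CompactSpace X] {d : ℝ} (hd : 0 < d) {ε : ℝ}
    (hε : 0 < ε) :
    ∀ᶠ i in Filter.atTop, ∀ x : X, ∃ v ∈ initialNet d O.ask i, dist x v < ε := by
  obtain ⟨J, hJ⟩ := exists_pow_lt_of_lt_one hε (by norm_num : (2 : ℝ)⁻¹ < 1)
  obtain ⟨M, hM⟩ := exists_separated_length_le (X := X) (ε := (2 : ℝ)⁻¹ ^ J) (by positivity)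
  have hsize : Filter.Tendsto (fun i => netSize d i) Filter.atTop Filter.atTop := by
    refine tendsto_nat_floor_atTop.comp (Filter.Tendsto.atTop_div_const (by norm_num) ?_)
    exact (tendsto_rpow_atTop (by positivity)).comp
      (tendsto_pow_atTop_atTop_of_one_lt (by norm_num))
  filter_upwards [hsize.eventually_gt_atTop M, Filter.eventually_ge_atTop J] with i hi hiJ x
  have hP : O.ask 0 ((greedyNet O.ask ((2 : ℝ)⁻¹ ^ J) (netSize d i)).map
      fun v => (v, (2 : ℝ)⁻¹ ^ J)) = none := by
    refine (greedyNet_complete_or_length_eq O.ask _ _).resolve_right fun h => ?_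
    have := hM _ (greedyNet_separated O ((2 : ℝ)⁻¹ ^ J) (netSize d i))
    omega
  -- The search for `netLevel` is not cut off before `J`.
  have hJi : J ≤ 2 ^ i := hiJ.trans Nat.lt_two_pow_self.le
  have hlevel : J ≤ netLevel d O.ask i := by
    unfold netLevel
    exact Nat.le_findGreatest hJi hP
  have hnone : O.ask 0 ((initialNet d O.ask i).map
      fun v => (v, (2 : ℝ)⁻¹ ^ netLevel d O.ask i)) = none := by
    unfold initialNet netLevel
    classical
    exact Nat.findGreatest_spec (P := fun j => O.ask 0 ((greedyNet O.ask ((2 : ℝ)⁻¹ ^ j)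
      (netSize d i)).map fun v => (v, (2 : ℝ)⁻¹ ^ j)) = none) hJi hP
  obtain ⟨v, hv, hxv⟩ := exists_mem_dist_lt O hnone (x := x) (by
    rw [Fin.castSucc_zero, D.zero]; exact mem_univ x)
  refine ⟨v, hv, hxv.trans_le (le_trans ?_ hJ.le)⟩
  exact pow_le_pow_of_le_one (by norm_num) (by norm_num) hlevel

end Net

/-! ### The pools -/

section Pools

variable {X : Type*}

theorem playCount_le_cons (p : X × ℝ) (h : List (X × ℝ)) (v : X) :
    playCount h v ≤ playCount (p :: h) v := by
  obtain ⟨u, r⟩ := p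
  by_cases huv : u = v
  · subst huv; rw [playCount_cons_self]; omega
  · rw [playCount_cons_of_ne huv]

theorem confRadius_cons_le (i : ℕ) (p : X × ℝ) (h : List (X × ℝ)) (v : X) :
    confRadius i (p :: h) v ≤ confRadius i h v := by
  have : (playCount h v : ℝ) ≤ playCount (p :: h) v := by
    exact_mod_cast playCount_le_cons p h v
  unfold confRadius
  gcongr

theorem confRadius_cons_of_ne (i : ℕ) {u v : X} (huv : u ≠ v) (r : ℝ) (h : List (X × ℝ)) :
    confRadius i ((u, r) :: h) v = confRadius i h v := by
  rw [confRadius, confRadius, playCount_cons_of_ne huv]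

/-- A single play at most halves the confidence radius. -/
theorem half_confRadius_le_cons (i : ℕ) (v : X) (r : ℝ) (h : List (X × ℝ)) :
    confRadius i h v / 2 ≤ confRadius i ((v, r) :: h) v := by
  have h4 : (2 : ℝ) = √4 := by
    rw [show (4 : ℝ) = 2 ^ 2 by norm_num, Real.sqrt_sq (by norm_num)]
  have h0 : (0 : ℝ) ≤ playCount h v := Nat.cast_nonneg _
  rw [confRadius, confRadius, playCount_cons_self]
  conv_lhs => rw [h4]
  rw [← Real.sqrt_div (by positivity), div_div]
  push_cast
  gcongr
  linarith

theorem confRadius_pos {i : ℕ} (hi : 1 ≤ i) (h : List (X × ℝ)) (v : X) :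
    0 < confRadius i h v := by
  have : (0 : ℝ) < i := by exact_mod_cast hi
  exact Real.sqrt_pos.2 (by positivity)

theorem one_lt_confRadius {i : ℕ} (hi : 1 ≤ i) {h : List (X × ℝ)} {v : X}
    (hv : playCount h v = 0) : 1 < confRadius i h v := by
  have : (1 : ℝ) ≤ i := by exact_mod_cast hi
  rw [confRadius, hv, Real.lt_sqrt (by norm_num)]
  push_cast
  linarith

variable {k : ℕ} (d : ℝ) (ask : Fin (k + 1) → List (X × ℝ) → Option X)

theorem activate_cases (i : ℕ) (h : List (X × ℝ)) (P : Fin (k + 1) → List X) :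
    (activate d ask i h P = P ∧ ∀ j, HasRoom (k := k) d i h (P j) →
      ask j ((active d ask i P).map fun v => (v, confRadius i h v)) = none) ∨
    ∃ j x, HasRoom (k := k) d i h (P j) ∧
      ask j ((active d ask i P).map fun v => (v, confRadius i h v)) = some x ∧
      activate d ask i h P = Function.update P j (x :: P j) := by
  classical
  unfold activate
  split
  · rename_i hnone
    refine Or.inl ⟨rfl, fun j hj => ?_⟩
    have := List.findSome?_eq_none_iff.1 hnone j (List.mem_finRange j)
    rw [if_pos hj] at this
    simpa using this
  · rename_i j x hsome
    right
    obtain ⟨j', -, hj'⟩ := List.exists_of_findSome?_eq_some hsome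
    split_ifs at hj' with hroom
    obtain ⟨y, hy, hyx⟩ := Option.map_eq_some_iff.1 hj'
    simp only [Prod.mk.injEq] at hyx
    obtain ⟨rfl, rfl⟩ := hyx
    exact ⟨j', y, hroom, hy, rfl⟩

/-- The pools right before the activation routine of the current round. -/
noncomputable def previousPools (i : ℕ) : List (X × ℝ) → Fin (k + 1) → List X
  | [] => fun _ => []
  | _ :: h => pools d ask i h

theorem pools_eq_activate (i : ℕ) (h : List (X × ℝ)) :
    pools d ask i h = activate d ask i h (previousPools d ask i h) := by
  cases h <;> rfl

theorem previousPools_subset (i : ℕ) (h : List (X × ℝ)) (m : Fin (k + 1)) :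
    previousPools d ask i h m ⊆ pools d ask i h m := by
  rw [pools_eq_activate]
  rcases activate_cases d ask i h (previousPools d ask i h) with ⟨he, -⟩ | ⟨j, x, -, -, he⟩
  · rw [he]; exact List.Subset.refl _
  · rw [he]
    by_cases hm : m = j
    · subst hm
      rw [Function.update_self]
      exact List.subset_cons_self _ _
    · rw [Function.update_of_ne hm]; exact List.Subset.refl _

theorem mem_active {i : ℕ} {P : Fin (k + 1) → List X} {v : X} :
    v ∈ active d ask i P ↔ v ∈ initialNet d ask i ∨ ∃ m, v ∈ P m := by
  simp [active, List.mem_flatMap]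

theorem previousActive_subset (i : ℕ) (h : List (X × ℝ)) :
    active d ask i (previousPools d ask i h) ⊆ active d ask i (pools d ask i h) := by
  intro v hv
  rw [mem_active] at hv ⊢
  exact hv.imp_right fun ⟨m, hm⟩ => ⟨m, previousPools_subset d ask i h m hm⟩

open Classical in
/-- The quotas are respected. -/
theorem countP_pools_le {i : ℕ} (hq : 0 ≤ quota d k i) (h : List (X × ℝ)) (m : Fin (k + 1)) :
    ((pools d ask i h m).countP fun u => rho d i ≤ confRadius i h u : ℝ) ≤ quota d k i := by
  have step : ∀ h, ((previousPools d ask i h m).countP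
      fun u => rho d i ≤ confRadius i h u : ℝ) ≤ quota d k i →
      ((pools d ask i h m).countP fun u => rho d i ≤ confRadius i h u : ℝ) ≤ quota d k i := by
    intro h hprev
    rw [pools_eq_activate]
    rcases activate_cases d ask i h (previousPools d ask i h) with
      ⟨he, -⟩ | ⟨j, x, hroom, -, he⟩
    · rw [he]; exact hprev
    · rw [he]
      by_cases hm : m = j
      · subst hm
        rw [Function.update_self, List.countP_cons]
        refine le_trans ?_ hroom
        push_cast
        gcongr
        split_ifs <;> simp
      · rw [Function.update_of_ne hm]; exact hprev
  refine step h ?_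
  induction h with
  | nil => simpa [previousPools] using hq
  | cons p h ih =>
    refine le_trans ?_ (step h ih)
    have : ((pools d ask i h m).countP fun u => decide (rho d i ≤ confRadius i (p :: h) u)) ≤
        ((pools d ask i h m).countP fun u => decide (rho d i ≤ confRadius i h u)) := by
      refine List.countP_mono_left fun u _ hu => ?_
      simp only [decide_eq_true_eq] at hu ⊢
      exact hu.trans (confRadius_cons_le i p h u)
    exact_mod_cast this

end Pools

/-! ### A phase without large deviations -/

section Phase

variable {X : Type*} [MetricSpace X] {k : ℕ} {dstar : ℝ} {D : FatDecomposition X dstar k}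

/-- The history of a phase of the algorithm in which, before each play, all averages were within
the confidence radii of the means. -/
def CleanRun [Nonempty X] (I : BanditInstance X) (d : ℝ)
    (ask : Fin (k + 1) → List (X × ℝ) → Option X) (i : ℕ) : List (X × ℝ) → Prop
  | [] => True
  | p :: h => CleanRun I d ask i h ∧ ¬ Deviates I i h ∧ p.1 = phaseAlgorithm d ask i h

theorem BanditInstance.mean_le_add_dist (I : BanditInstance X) (x y : X) :
    I.mean x ≤ I.mean y + dist x y := by
  have := (abs_le.1 (I.lipschitz x y)).2
  unfold BanditInstance.mean
  linarith

/-- The members of a pool belong to the corresponding set of the decomposition, and keep the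
distance of the confidence radii. -/
theorem pools_separated (O : CoveringOracle D) (d : ℝ) (i : ℕ) (h : List (X × ℝ))
    (m : Fin (k + 1)) :
    (∀ u ∈ pools d O.ask i h m, u ∈ D.S m.castSucc) ∧
      (pools d O.ask i h m).Pairwise fun u v => confRadius i h v ≤ dist u v := by
  have step : ∀ h, ((∀ u ∈ previousPools d O.ask i h m, u ∈ D.S m.castSucc) ∧
      (previousPools d O.ask i h m).Pairwise fun u v => confRadius i h v ≤ dist u v) →
      (∀ u ∈ pools d O.ask i h m, u ∈ D.S m.castSucc) ∧
      (pools d O.ask i h m).Pairwise fun u v => confRadius i h v ≤ dist u v := by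
    intro h hprev
    rw [pools_eq_activate]
    rcases activate_cases d O.ask i h (previousPools d O.ask i h) with
      ⟨he, -⟩ | ⟨j, x, -, hx, he⟩
    · rw [he]; exact hprev
    · rw [he]
      by_cases hm : m = j
      · subst hm
        rw [Function.update_self]
        have hunc := O.uncovered _ _ _ hx
        refine ⟨fun u hu => ?_, List.pairwise_cons.2 ⟨fun v hv => ?_, hprev.2⟩⟩
        · rcases List.mem_cons.1 hu with rfl | hu
          · exact hunc.1
          · exact hprev.1 u hu
        · have := hunc.2 (v, confRadius i h v) (List.mem_map.2
            ⟨v, (mem_active d O.ask).2 (Or.inr ⟨m, hv⟩), rfl⟩)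
          simpa [Metric.mem_ball] using this
      · rw [Function.update_of_ne hm]; exact hprev
  refine step h ?_
  induction h with
  | nil => simp [previousPools]
  | cons p h ih =>
    have := step h ih
    exact ⟨this.1, this.2.imp fun {u v} huv => (confRadius_cons_le i p h v).trans huv⟩

variable [Nonempty X]

theorem phaseAlgorithm_spec {X : Type*} [Nonempty X] (d : ℝ)
    (ask : Fin (k + 1) → List (X × ℝ) → Option X) (i : ℕ) (h : List (X × ℝ))
    (hne : initialNet d ask i ≠ []) :
    phaseAlgorithm d ask i h ∈ active d ask i (pools d ask i h) ∧
      ∀ v ∈ active d ask i (pools d ask i h),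
        index i h v ≤ index i h (phaseAlgorithm d ask i h) := by
  classical
  have hne' : active d ask i (pools d ask i h) ≠ [] := by
    unfold active
    exact fun hc => hne (List.append_eq_nil_iff.1 hc).1
  cases hL : (active d ask i (pools d ask i h)).argmax (index i h) with
  | none => exact absurd (List.argmax_eq_none.1 hL) hne'
  | some u =>
    have hu : phaseAlgorithm d ask i h = u := by simp [phaseAlgorithm, hL]
    rw [hu]
    exact ⟨List.argmax_mem hL, fun v hv => List.le_of_mem_argmax hv hL⟩

/-- The optimism principle: the index of the strategy played is at least that of every active
strategy, and the indices are close to the means. -/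
theorem mean_add_confRadius_le {I : BanditInstance X} {d : ℝ}
    {ask : Fin (k + 1) → List (X × ℝ) → Option X} {i : ℕ} {h : List (X × ℝ)}
    (hdev : ¬ Deviates I i h) (hne : initialNet d ask i ≠ []) {v : X}
    (hv : v ∈ active d ask i (pools d ask i h)) :
    I.mean v + confRadius i h v ≤ I.mean (phaseAlgorithm d ask i h) +
      3 * confRadius i h (phaseAlgorithm d ask i h) := by
  have h1 := (phaseAlgorithm_spec d ask i h hne).2 v hv
  simp only [Deviates, not_exists, not_lt] at hdev
  have h2 := (abs_le.1 (hdev v)).1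
  have h3 := (abs_le.1 (hdev (phaseAlgorithm d ask i h))).2
  simp only [index] at h1
  linarith

/-- The strategies played so far were active before the activation routine of the current round;
hence a newly activated strategy has not been played. -/
theorem mem_previousActive_of_played {I : BanditInstance X} {d : ℝ}
    {ask : Fin (k + 1) → List (X × ℝ) → Option X} {i : ℕ} (hne : initialNet d ask i ≠ [])
    {h : List (X × ℝ)} (hrun : CleanRun I d ask i h) {v : X} (hv : playCount h v ≠ 0) :
    v ∈ active d ask i (previousPools d ask i h) := by
  induction h with
  | nil => simp [playCount] at hv
  | cons p h ih =>
    obtain ⟨u, r⟩ := p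
    by_cases huv : u = v
    · subst huv
      have := (phaseAlgorithm_spec d ask i h hne).1
      rw [← hrun.2.2] at this
      exact this
    · rw [playCount_cons_of_ne huv] at hv
      exact previousActive_subset d ask i h (ih hrun.1 hv)

/-- If the pool of `S_m` has room, then `S_m` is covered when the next strategy is chosen. In a
round that activates a strategy, the confidence ball of this strategy is the whole space. -/
theorem exists_active_dist_lt (hdiam : ∀ x y : X, dist x y ≤ 1) (O : CoveringOracle D)
    {I : BanditInstance X} {d : ℝ} {i : ℕ} (hi : 1 ≤ i) (hne : initialNet d O.ask i ≠ [])
    {h : List (X × ℝ)} (hrun : CleanRun I d O.ask i h) {m : Fin (k + 1)}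
    (hroom : HasRoom (k := k) d i h (pools d O.ask i h m)) {x : X} (hx : x ∈ D.S m.castSucc) :
    ∃ v ∈ active d O.ask i (pools d O.ask i h), dist x v < confRadius i h v := by
  rw [pools_eq_activate] at hroom ⊢
  rcases activate_cases d O.ask i h (previousPools d O.ask i h) with
    ⟨he, hcov⟩ | ⟨j, y, -, hy, he⟩
  · rw [he] at hroom ⊢
    exact exists_mem_dist_lt O (hcov m hroom) hx
  · rw [he]
    refine ⟨y, (mem_active d O.ask).2 (Or.inr ⟨j, by simp⟩), (hdiam x y).trans_lt ?_⟩
    refine one_lt_confRadius hi ?_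
    by_contra hplay
    have hmem := mem_previousActive_of_played hne hrun hplay
    have := (O.uncovered _ _ _ hy).2 (y, confRadius i h y) (List.mem_map.2 ⟨y, hmem, rfl⟩)
    exact this (Metric.mem_ball_self (confRadius_pos hi h y))

/-- A strategy with a large gap is not played often: as soon as its confidence radius is small, some
strategy of the initial net has a larger index. -/
theorem le_confRadius_of_gap {I : BanditInstance X} {d : ℝ}
    {ask : Fin (k + 1) → List (X × ℝ) → Option X} {i : ℕ} (hi : 1 ≤ i) {δ : ℝ}
    (hδ1 : δ ≤ 1) {xs : X} (hnet : ∃ v ∈ initialNet d ask i, dist xs v < δ / 2)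
    {h : List (X × ℝ)} (hrun : CleanRun I d ask i h) {u : X} (hu : I.mean u ≤ I.mean xs - δ) :
    δ / 12 ≤ confRadius i h u := by
  obtain ⟨v, hv, hxv⟩ := hnet
  induction h with
  | nil =>
    have := one_lt_confRadius (h := ([] : List (X × ℝ))) (v := u) hi (by simp [playCount])
    linarith
  | cons p h ih =>
    obtain ⟨w, r⟩ := p
    by_cases hwu : w = u
    · subst hwu
      have hne : initialNet d ask i ≠ [] := List.ne_nil_of_mem hv
      have h1 := mean_add_confRadius_le hrun.2.1 hne
        ((mem_active d ask).2 (Or.inl hv) : v ∈ active d ask i (pools d ask i h))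
      rw [← hrun.2.2] at h1
      simp only at h1
      have h2 := confRadius_pos hi h v
      have h3 := I.mean_le_add_dist xs v
      have h4 := half_confRadius_le_cons i w r h
      -- At the time of this play the radius was at least `δ / 6`, and the play at most halves it.
      linarith
    · rw [confRadius_cons_of_ne i hwu]
      exact ih hrun.1

open Classical in
/-- The pool of `S_m` holds few strategies of large confidence radius: those of small gap are
separated and hence counted by the covering number of `S_m` without the strategies of large gap,
and those of large gap keep a large confidence radius, so that there are boundedly many. -/
theorem countP_pool_le (O : CoveringOracle D) {I : BanditInstance X} {d : ℝ} {i : ℕ}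
    (hi : 1 ≤ i) {δ : ℝ} (hδ1 : δ ≤ 1) {xs : X}
    (hnet : ∃ v ∈ initialNet d O.ask i, dist xs v < δ / 2) {h : List (X × ℝ)}
    (hrun : CleanRun I d O.ask i h) (m : Fin (k + 1)) {M : ℕ}
    (hM : ∀ l : List X, (l.Pairwise fun x y => δ / 12 ≤ dist x y) → l.length ≤ M)
    {c e : ℝ} (hρ : 0 < rho d i)
    (hcov : (coveringNumber (D.S m.castSucc \ {x | I.mean x < I.mean xs - δ}) (rho d i / 2) :
      ENNReal) ≤ ENNReal.ofReal (c * (rho d i / 2) ^ (-e))) :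
    ((pools d O.ask i h m).countP fun u => rho d i ≤ confRadius i h u : ℝ) ≤
      M + max (c * (rho d i / 2) ^ (-e)) 0 := by
  obtain ⟨hS, hsep⟩ := pools_separated O d i h m
  set l := pools d O.ask i h m
  set q : X → Bool := fun u => decide (I.mean u < I.mean xs - δ) with hq
  -- Strategies of gap larger than `δ` are counted first, the others second.
  rw [List.countP_eq_countP_filter_add l _ q]
  push_cast
  refine add_le_add ?_ ?_
  · have h1 : (l.filter q).length ≤ M := by
      refine hM _ (List.pairwise_filter.2 (hsep.imp fun {u v} huv _ hqv => ?_))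
      simp only [hq, decide_eq_true_eq] at hqv
      exact (le_confRadius_of_gap hi hδ1 hnet hrun hqv.le).trans huv
    exact_mod_cast List.countP_le_length.trans h1
  · rw [List.countP_eq_length_filter, List.filter_filter]
    refine length_le_of_coveringNumber_le (ε := rho d i) (by positivity) (by linarith) hcov ?_ ?_
    · intro x hx
      simp only [List.mem_filter, hq, Bool.and_eq_true, decide_eq_true_eq, Bool.not_eq_true',
        decide_eq_false_iff_not] at hx
      exact ⟨hS x hx.1, hx.2.2⟩
    · refine List.pairwise_filter.2 (hsep.imp fun {u v} huv _ hv => ?_)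
      simp only [Bool.and_eq_true, decide_eq_true_eq] at hv
      exact hv.1.trans huv

/-- If the pool of `S_m` always has room and `S_m` contains an optimal strategy, then the gap of the
strategy played is at most three times its confidence radius. -/
theorem mean_le_phaseAlgorithm (hdiam : ∀ x y : X, dist x y ≤ 1) (O : CoveringOracle D)
    {I : BanditInstance X} {d : ℝ} {i : ℕ} (hi : 1 ≤ i) (hne : initialNet d O.ask i ≠ [])
    {h : List (X × ℝ)} (hrun : CleanRun I d O.ask i h) (hdev : ¬ Deviates I i h)
    {m : Fin (k + 1)} (hroom : HasRoom (k := k) d i h (pools d O.ask i h m)) {xs : X}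
    (hxs : xs ∈ D.S m.castSucc) :
    I.mean xs ≤ I.mean (phaseAlgorithm d O.ask i h) +
      3 * confRadius i h (phaseAlgorithm d O.ask i h) := by
  obtain ⟨v, hv, hxv⟩ := exists_active_dist_lt hdiam O hi hne hrun hroom hxs
  have h1 := mean_add_confRadius_le hdev hne hv
  have h2 := I.mean_le_add_dist xs v
  linarith

end Phase

/-! ### The sum of the confidence radii -/

section RadiusSum

variable {X : Type*}

/-- The sum of the confidence radii of the strategies played, each at the time of its play. -/
noncomputable def radiusSum (i : ℕ) : List (X × ℝ) → ℝ
  | [] => 0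
  | p :: h => confRadius i h p.1 + radiusSum i h

/-- The increments of `2 √n` dominate the confidence radii, up to the factor `√(8 i)`. -/
theorem sqrt_add_two_le (n : ℕ) : 1 / √(2 + (n : ℝ)) ≤ 2 * (√((n : ℝ) + 1) - √n) := by
  have h0 : (0 : ℝ) ≤ n := Nat.cast_nonneg n
  have ha : 0 ≤ √(n : ℝ) := Real.sqrt_nonneg _
  have hb : √(n : ℝ) ≤ √((n : ℝ) + 1) := Real.sqrt_le_sqrt (by linarith)
  have hc : √((n : ℝ) + 1) ≤ √(2 + (n : ℝ)) := Real.sqrt_le_sqrt (by linarith)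
  have hcp : 0 < √(2 + (n : ℝ)) := Real.sqrt_pos.2 (by linarith)
  have ha2 := Real.sq_sqrt h0
  have hb2 := Real.sq_sqrt (by linarith : (0 : ℝ) ≤ (n : ℝ) + 1)
  rw [div_le_iff₀ hcp]
  nlinarith [mul_nonneg (sub_nonneg.2 hb) (sub_nonneg.2 hc),
    mul_nonneg (sub_nonneg.2 hb) (sub_nonneg.2 (hb.trans hc))]

theorem radiusSum_le_sum_sqrt (i : ℕ) (h : List (X × ℝ)) (W : Finset X)
    (hW : ∀ p ∈ h, p.1 ∈ W) :
    radiusSum i h ≤ ∑ v ∈ W, 2 * √(8 * i) * √(playCount h v) := by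
  induction h with
  | nil => simp [radiusSum, playCount]
  | cons p h ih =>
    obtain ⟨u, r⟩ := p
    have hu : u ∈ W := hW (u, r) (by simp)
    have ih := ih fun p hp => hW p (by simp [hp])
    have hdiff : ∑ v ∈ W, 2 * √(8 * (i : ℝ)) * √(playCount ((u, r) :: h) v) =
        ∑ v ∈ W, 2 * √(8 * (i : ℝ)) * √(playCount h v) +
          2 * √(8 * (i : ℝ)) * (√((playCount h u : ℝ) + 1) - √(playCount h u)) := by
      rw [← sub_eq_iff_eq_add', ← Finset.sum_sub_distrib, Finset.sum_eq_single u]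
      · rw [playCount_cons_self]; push_cast; ring
      · intro v _ hv
        rw [playCount_cons_of_ne (Ne.symm hv)]; ring
      · intro hc; exact absurd hu hc
    rw [hdiff, radiusSum]
    have hconf : confRadius i h u ≤
        2 * √(8 * (i : ℝ)) * (√((playCount h u : ℝ) + 1) - √(playCount h u)) := by
      rw [confRadius, Real.sqrt_div (by positivity), div_eq_mul_one_div]
      have := mul_le_mul_of_nonneg_left (sqrt_add_two_le (playCount h u))
        (Real.sqrt_nonneg (8 * (i : ℝ)))
      linarith
    simp only
    linarith

open Classical in
/-- The sum of the radii in terms of the number of strategies played, at any scale `ρ`. -/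
theorem radiusSum_le (i : ℕ) (h : List (X × ℝ)) {ρ : ℝ} (hρ : 0 < ρ) :
    radiusSum i h ≤ h.length * ρ + (h.map Prod.fst).toFinset.card * (8 * i / ρ) := by
  refine (radiusSum_le_sum_sqrt i h _ fun p hp =>
    List.mem_toFinset.2 (List.mem_map_of_mem hp)).trans ?_
  have hterm : ∀ v ∈ (h.map Prod.fst).toFinset,
      2 * √(8 * (i : ℝ)) * √(playCount h v) ≤ playCount h v * ρ + 8 * i / ρ := by
    intro v _
    have ha := Real.sq_sqrt (by positivity : (0 : ℝ) ≤ 8 * i)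
    have hb := Real.sq_sqrt (Nat.cast_nonneg (playCount h v) : (0 : ℝ) ≤ playCount h v)
    -- The inequality between the arithmetic and the geometric mean, balanced at scale `ρ`.
    have hsq : 0 ≤ (√(playCount h v : ℝ) * ρ - √(8 * (i : ℝ))) ^ 2 / ρ := by positivity
    have : (√(playCount h v : ℝ) * ρ - √(8 * (i : ℝ))) ^ 2 / ρ =
        √(playCount h v : ℝ) ^ 2 * ρ + √(8 * (i : ℝ)) ^ 2 / ρ -
          2 * √(8 * (i : ℝ)) * √(playCount h v) := by
      field_simp
      ring
    rw [this, ha, hb] at hsq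
    linarith
  refine (Finset.sum_le_sum hterm).trans ?_
  rw [Finset.sum_add_distrib, ← Finset.sum_mul, Finset.sum_const, nsmul_eq_mul,
    ← Nat.cast_sum, sum_playCount]

end RadiusSum

/-! ### The threshold and the quota -/

section Quota

variable {d : ℝ}

theorem rho_pos (d : ℝ) (i : ℕ) : 0 < rho d i := Real.rpow_pos_of_pos (by positivity) _

theorem rho_le_one (hd : 0 < d) (i : ℕ) : rho d i ≤ 1 := by
  refine Real.rpow_le_one_of_one_le_of_nonpos (one_le_pow₀ (by norm_num)) ?_
  exact div_nonpos_of_nonpos_of_nonneg (by norm_num) (by linarith)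

theorem inv_rho (d : ℝ) (i : ℕ) : (rho d i)⁻¹ = ((2 : ℝ) ^ i) ^ (1 / (d + 2)) := by
  rw [rho, neg_div, Real.rpow_neg (by positivity), inv_inv]

theorem tendsto_inv_rho (hd : 0 < d) :
    Filter.Tendsto (fun i => (rho d i)⁻¹) Filter.atTop Filter.atTop := by
  simp_rw [inv_rho]
  exact (tendsto_rpow_atTop (by positivity)).comp
    (tendsto_pow_atTop_atTop_of_one_lt (by norm_num))

theorem logb_one_div_rho (d : ℝ) (i : ℕ) : Real.logb 2 (1 / rho d i) = i / (d + 2) := by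
  rw [one_div, inv_rho, Real.logb_rpow_eq_mul_logb_of_pos (by positivity), Real.logb_pow,
    Real.logb_self_eq_one (by norm_num)]
  ring

theorem rho_rpow_neg (d : ℝ) (i : ℕ) :
    rho d i ^ (-d) = ((2 : ℝ) ^ i) ^ (d / (d + 2)) := by
  rw [rho, ← Real.rpow_mul (by positivity)]
  congr 1
  ring

theorem two_pow_mul_rho_sq (hd : 0 < d) (i : ℕ) :
    (2 : ℝ) ^ i * rho d i ^ 2 = ((2 : ℝ) ^ i) ^ (d / (d + 2)) := by
  rw [rho, ← Real.rpow_natCast (_ ^ (_ : ℝ)) 2, ← Real.rpow_mul (by positivity)]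
  conv_lhs => enter [1]; rw [← Real.rpow_one ((2 : ℝ) ^ i)]
  rw [← Real.rpow_add (by positivity)]
  congr 1
  have : d + 2 ≠ 0 := by linarith
  push_cast
  field_simp
  ring

theorem two_pow_mul_rho (d : ℝ) (i : ℕ) :
    (2 : ℝ) ^ i * rho d i = ((2 : ℝ) ^ i) ^ (1 - 1 / (d + 2)) := by
  rw [rho]
  conv_lhs => enter [1]; rw [← Real.rpow_one ((2 : ℝ) ^ i)]
  rw [← Real.rpow_add (by positivity)]
  congr 1
  ring

theorem quota_nonneg (hd : 0 < d) (k i : ℕ) : 0 ≤ quota d k i := by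
  have := rho_pos d i
  rw [quota, logb_one_div_rho]
  positivity

theorem quota_le (hd : 0 < d) (k : ℕ) {i : ℕ} (hi : d + 2 ≤ i) :
    quota d k i ≤ ((2 : ℝ) ^ i) ^ (d / (d + 2)) := by
  rw [quota, logb_one_div_rho, rho_rpow_neg d]
  refine mul_le_of_le_one_left (by positivity) (inv_le_one_of_one_le₀ ?_)
  have h1 : (1 : ℝ) ≤ i / (d + 2) := by rw [le_div_iff₀ (by linarith)]; linarith
  have h2 : (1 : ℝ) ≤ (max k 1 : ℕ) := by exact_mod_cast le_max_right k 1
  nlinarith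

/-- The quota eventually exceeds every bound of order `ρ⁻ᵉ` with `e < d`, in spite of its
logarithmic factor. -/
theorem eventually_le_quota (hd : 0 < d) (k : ℕ) {e : ℝ} (hed : e < d) (M : ℕ) (c : ℝ) :
    ∀ᶠ i in Filter.atTop, M + max (c * (rho d i / 2) ^ (-e)) 0 + 1 ≤ quota d k i := by
  set e' := max e 0 with he'
  have he'd : 0 < d - e' := by
    rw [sub_pos]; exact max_lt hed hd
  set C₀ : ℝ := M + 1 + |c| * 2 ^ e with hC₀
  have hC₀pos : 0 < C₀ := by positivity
  set K : ℝ := 64 * (max k 1 : ℕ) with hK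
  have hKpos : 0 < K := by
    have : (1 : ℝ) ≤ (max k 1 : ℕ) := by exact_mod_cast le_max_right k 1
    positivity
  have hlog2 : 0 < Real.log 2 := Real.log_pos (by norm_num)
  have hlo := (isLittleO_log_rpow_atTop he'd).def
    (c := Real.log 2 / (C₀ * K)) (by positivity)
  have hmain : ∀ᶠ y : ℝ in Filter.atTop,
      M + max (c * (2 ^ e * y ^ e)) 0 + 1 ≤ (K * Real.logb 2 y)⁻¹ * y ^ d := by
    filter_upwards [hlo, Filter.eventually_gt_atTop 1] with y hy hy1
    have hy0 : 0 < y := by linarith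
    have hlogy : 0 < Real.log y := Real.log_pos hy1
    rw [Real.norm_of_nonneg hlogy.le, Real.norm_of_nonneg (by positivity)] at hy
    have hlogb : 0 < Real.logb 2 y := Real.logb_pos (by norm_num) hy1
    have h1 : (1 : ℝ) ≤ y ^ e' := Real.one_le_rpow hy1.le (le_max_right _ _)
    have h2 : y ^ e ≤ y ^ e' := Real.rpow_le_rpow_of_exponent_le hy1.le (le_max_left _ _)
    have h3 : max (c * (2 ^ e * y ^ e)) 0 ≤ |c| * 2 ^ e * y ^ e' := by
      refine max_le ?_ (by positivity)
      calc c * (2 ^ e * y ^ e) ≤ |c| * (2 ^ e * y ^ e) := by gcongr; exact le_abs_self c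
        _ ≤ |c| * (2 ^ e * y ^ e') := by gcongr
        _ = _ := by ring
    have h4 : M + max (c * (2 ^ e * y ^ e)) 0 + 1 ≤ C₀ * y ^ e' := by
      have : ((M : ℝ) + 1) * 1 ≤ (M + 1) * y ^ e' := by gcongr
      rw [hC₀]
      linarith
    refine h4.trans ?_
    rw [← div_eq_inv_mul, le_div_iff₀ (by positivity)]
    have h5 : K * Real.logb 2 y * C₀ ≤ y ^ (d - e') := by
      rw [Real.logb]
      rw [div_mul_eq_mul_div, le_div_iff₀ (by positivity)] at hy
      rw [mul_div_assoc', div_mul_eq_mul_div, div_le_iff₀ hlog2]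
      linarith
    calc C₀ * y ^ e' * (K * Real.logb 2 y) = K * Real.logb 2 y * C₀ * y ^ e' := by ring
      _ ≤ y ^ (d - e') * y ^ e' := by gcongr
      _ = y ^ d := by rw [← Real.rpow_add hy0]; congr 1; ring
  filter_upwards [(tendsto_inv_rho hd).eventually hmain] with i hi
  have hρ := rho_pos d i
  have h1 : (rho d i / 2) ^ (-e) = 2 ^ e * (rho d i)⁻¹ ^ e := by
    rw [Real.rpow_neg (by positivity), ← Real.inv_rpow (by positivity), inv_div,
      div_eq_mul_inv, Real.mul_rpow (by norm_num) (by positivity)]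
  have h2 : quota d k i = (K * Real.logb 2 (rho d i)⁻¹)⁻¹ * (rho d i)⁻¹ ^ d := by
    rw [quota, one_div, Real.rpow_neg hρ.le, ← Real.inv_rpow hρ.le]
  rw [h1, h2]
  exact hi

end Quota

/-! ### The regret of a phase -/

section PhaseRegret

variable {X : Type*} [MetricSpace X]

theorem BanditInstance.continuous_mean (I : BanditInstance X) : Continuous I.mean := by
  refine (LipschitzWith.of_dist_le_mul (K := 1) fun x y => ?_).continuous
  rw [Real.dist_eq, NNReal.coe_one, one_mul]
  exact I.lipschitz x y

/-- The deepest set of the decomposition that contains an optimal strategy. -/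
theorem FatDecomposition.exists_deepest {k : ℕ} {d : ℝ} (D : FatDecomposition X d k) (Q : X → Prop)
    (hQ : ∃ x, Q x) :
    ∃ m : Fin (k + 1), (∃ x ∈ D.S m.castSucc, Q x) ∧ ∀ x ∈ D.S m.succ, ¬ Q x := by
  by_contra hcon
  push Not at hcon
  have hall : ∀ j : Fin (k + 2), ∃ x ∈ D.S j, Q x := by
    intro j
    induction j using Fin.induction with
    | zero =>
      obtain ⟨x, hx⟩ := hQ
      exact ⟨x, by rw [D.zero]; exact mem_univ x, hx⟩
    | succ m ih =>
      obtain ⟨x, hx, hq⟩ := ih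
      exact hcon m ⟨x, hx, hq⟩
  obtain ⟨x, hx, -⟩ := hall (Fin.last (k + 1))
  rw [D.last] at hx
  exact hx

variable [Nonempty X] {k : ℕ} {dstar : ℝ}

open Classical in
/-- The number of strategies played: those of small confidence radius have been played at least
`1 / ρ²` times each, and the others belong to the initial net or count towards a quota. -/
theorem card_played_le {I : BanditInstance X} {d : ℝ} (hd : 0 < d)
    {ask : Fin (k + 1) → List (X × ℝ) → Option X} {i : ℕ} (hi : 1 ≤ i)
    (hne : initialNet d ask i ≠ []) {h : List (X × ℝ)} (hrun : CleanRun I d ask i h) :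
    ((h.map Prod.fst).toFinset.card : ℝ) ≤
      h.length * rho d i ^ 2 + (netSize d i + (k + 1) * quota d k i) := by
  have hρ := rho_pos d i
  set W := (h.map Prod.fst).toFinset with hW
  rw [← Finset.card_filter_add_card_filter_not (s := W) fun v => confRadius i h v < rho d i]
  push_cast
  refine add_le_add ?_ ?_
  · have hone : ∀ v ∈ W.filter (fun v => confRadius i h v < rho d i),
        (1 : ℝ) ≤ playCount h v * rho d i ^ 2 := by
      intro v hv
      have hlt := (Finset.mem_filter.1 hv).2
      have hi1 : (1 : ℝ) ≤ i := by exact_mod_cast hi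
      have hn : (0 : ℝ) ≤ playCount h v := Nat.cast_nonneg _
      rw [confRadius, Real.sqrt_lt' hρ, div_lt_iff₀ (by linarith)] at hlt
      have hρ2 : rho d i ^ 2 ≤ 1 := pow_le_one₀ hρ.le (rho_le_one hd i)
      linarith
    calc _ = ∑ v ∈ W.filter (fun v => confRadius i h v < rho d i), (1 : ℝ) := by simp
      _ ≤ ∑ v ∈ W.filter (fun v => confRadius i h v < rho d i),
          playCount h v * rho d i ^ 2 := Finset.sum_le_sum hone
      _ ≤ ∑ v ∈ W, playCount h v * rho d i ^ 2 :=
        Finset.sum_le_sum_of_subset_of_nonneg (Finset.filter_subset _ _)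
          fun v _ _ => by positivity
      _ = _ := by rw [← Finset.sum_mul, ← Nat.cast_sum, sum_playCount]
  · have hsub : W.filter (fun v => ¬ confRadius i h v < rho d i) ⊆
        (initialNet d ask i).toFinset ∪ Finset.univ.biUnion fun m : Fin (k + 1) =>
          ((pools d ask i h m).filter fun u => decide (rho d i ≤ confRadius i h u)).toFinset := by
      intro v hv
      rw [Finset.mem_filter, not_lt] at hv
      have hplay : playCount h v ≠ 0 := by
        rw [Ne, playCount_eq_zero_iff, not_not]
        exact List.mem_toFinset.1 hv.1
      have hact := previousActive_subset d ask i h (mem_previousActive_of_played hne hrun hplay)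
      rcases (mem_active d ask).1 hact with h1 | ⟨m, hm⟩
      · exact Finset.mem_union_left _ (List.mem_toFinset.2 h1)
      · refine Finset.mem_union_right _ (Finset.mem_biUnion.2 ⟨m, Finset.mem_univ m, ?_⟩)
        rw [List.mem_toFinset, List.mem_filter]
        exact ⟨hm, by simpa using hv.2⟩
    have hcard := (Finset.card_le_card hsub).trans ((Finset.card_union_le _ _).trans
      (add_le_add (List.toFinset_card_le _) Finset.card_biUnion_le))
    refine (Nat.cast_le (α := ℝ) |>.2 hcard).trans ?_
    push_cast
    refine add_le_add ?_ ?_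
    · exact_mod_cast length_greedyNet_le ask _ _
    · calc _ ≤ ∑ _m : Fin (k + 1), quota d k i := by
            refine Finset.sum_le_sum fun m _ => ?_
            refine le_trans ?_ (countP_pools_le d ask (quota_nonneg hd k i) h m)
            rw [List.countP_eq_length_filter]
            exact_mod_cast List.toFinset_card_le _
        _ = _ := by simp

theorem sum_gap_le_radiusSum {I : BanditInstance X} {d : ℝ}
    {ask : Fin (k + 1) → List (X × ℝ) → Option X} {i : ℕ} {M : ℝ}
    (hstep : ∀ h, CleanRun I d ask i h → ¬ Deviates I i h →
      M ≤ I.mean (phaseAlgorithm d ask i h) + 3 * confRadius i h (phaseAlgorithm d ask i h))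
    {h : List (X × ℝ)} (hrun : CleanRun I d ask i h) :
    (h.map fun p => M - I.mean p.1).sum ≤ 3 * radiusSum i h := by
  induction h with
  | nil => simp [radiusSum]
  | cons p h ih =>
    have h1 := ih hrun.1
    have h2 := hstep h hrun.1 hrun.2.1
    rw [← hrun.2.2] at h2
    simp only [List.map_cons, List.sum_cons, radiusSum]
    linarith

/-- At an optimal strategy in the deepest possible set of the decomposition, the strategies of small
gap in this set have covering dimension at most `dstar`. -/
theorem exists_gap [CompactSpace X] (D : FatDecomposition X dstar k) (I : BanditInstance X) :
    ∃ (m : Fin (k + 1)) (xs : X) (δ : ℝ), xs ∈ D.S m.castSucc ∧ (∀ x, I.mean x ≤ I.mean xs) ∧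
      0 < δ ∧ δ ≤ 1 ∧
      covDim (D.S m.castSucc \ {x | I.mean x < I.mean xs - δ}) ≤ dstar := by
  obtain ⟨x₀, -, hx₀⟩ := isCompact_univ.exists_isMaxOn (univ_nonempty (α := X))
    I.continuous_mean.continuousOn
  obtain ⟨m, ⟨xs, hxs, hxsM⟩, hdeep⟩ :=
    D.exists_deepest (fun x => I.mean x = I.mean x₀) ⟨x₀, rfl⟩
  have hmax : ∀ x, I.mean x ≤ I.mean xs := fun x => by
    rw [hxsM]; exact hx₀ (mem_univ x)
  have hδ : ∃ δ : ℝ, 0 < δ ∧ δ ≤ 1 ∧ ∀ x ∈ D.S m.succ, I.mean x < I.mean xs - δ := by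
    rcases (D.S m.succ).eq_empty_or_nonempty with he | hne
    · exact ⟨1, one_pos, le_rfl, by simp [he]⟩
    · obtain ⟨z, hz, hzmax⟩ := (D.isClosed m.succ).isCompact.exists_isMaxOn hne
        I.continuous_mean.continuousOn
      have hlt : I.mean z < I.mean xs := lt_of_le_of_ne (hmax z) fun h =>
        hdeep z hz (h.trans hxsM)
      have h0 := (I.mean_mem_Icc z).1
      have h1 := (I.mean_mem_Icc xs).2
      refine ⟨(I.mean xs - I.mean z) / 2, by linarith, by linarith, fun x hx => ?_⟩
      have : I.mean x ≤ I.mean z := hzmax hx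
      linarith
  obtain ⟨δ, hδ0, hδ1, hδ⟩ := hδ
  exact ⟨m, xs, δ, hxs, hmax, hδ0, hδ1, D.covDim_diff m _
    (isOpen_lt I.continuous_mean continuous_const) hδ⟩

/-- The set of near-optimal strategies in `exists_gap` is not empty. -/
theorem FatDecomposition.dim_nonneg [CompactSpace X] (D : FatDecomposition X dstar k)
    (I : BanditInstance X) : 0 ≤ dstar := by
  obtain ⟨m, xs, δ, hxs, -, hδ, -, hdim⟩ := exists_gap D I
  have hmem : xs ∈ D.S m.castSucc \ {x | I.mean x < I.mean xs - δ} :=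
    ⟨hxs, by simp only [mem_ofPred_eq, not_lt]; linarith⟩
  have := (covDim_nonneg ⟨xs, hmem⟩).trans hdim
  exact_mod_cast this

/-- In all long phases without large deviations, the regret is at most of order `i T ^ γ`, where
`T = 2 ^ i` and `γ = 1 - 1 / (d + 2)`. -/
theorem eventually_sum_gap_le [CompactSpace X] (hdiam : ∀ x y : X, dist x y ≤ 1)
    {D : FatDecomposition X dstar k} {d : ℝ} (hd : dstar < d) (O : CoveringOracle D)
    (I : BanditInstance X) :
    ∃ xs : X, (∀ x, I.mean x ≤ I.mean xs) ∧ ∀ᶠ i : ℕ in Filter.atTop, ∀ h,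
      CleanRun I d O.ask i h → h.length ≤ 2 ^ i →
        (h.map fun p => I.mean xs - I.mean p.1).sum ≤
          24 * (k + 3) * (i + 1) * ((2 : ℝ) ^ i) ^ (1 - 1 / (d + 2)) := by
  classical
  have hd0 : 0 < d := (D.dim_nonneg I).trans_lt hd
  obtain ⟨m, xs, δ, hxs, hmax, hδ0, hδ1, hdim⟩ := exists_gap D I
  refine ⟨xs, hmax, ?_⟩
  have hlt : covDim (D.S m.castSucc \ {x | I.mean x < I.mean xs - δ}) < (d : EReal) :=
    hdim.trans_lt (by exact_mod_cast hd)
  obtain ⟨_, ⟨e, ⟨c, hc⟩, rfl⟩, hed⟩ := sInf_lt_iff.1 hlt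
  have hed : e < d := by exact_mod_cast hed
  obtain ⟨M, hM⟩ := exists_separated_length_le (X := X) (ε := δ / 12) (by positivity)
  obtain ⟨N, hN⟩ := exists_nat_ge (d + 2)
  filter_upwards [eventually_initialNet_dist_lt O hd0 (half_pos hδ0),
    eventually_le_quota hd0 k hed M c, Filter.eventually_ge_atTop N,
    Filter.eventually_ge_atTop 1] with i hnet hquota hiN hi h hrun hlen
  have hid : d + 2 ≤ i := hN.trans (by exact_mod_cast hiN)
  have hne : initialNet d O.ask i ≠ [] := by
    obtain ⟨v, hv, -⟩ := hnet xs
    exact List.ne_nil_of_mem hv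
  have hρ := rho_pos d i
  have hρ1 := rho_le_one hd0 i
  have hstep : ∀ h, CleanRun I d O.ask i h → ¬ Deviates I i h →
      I.mean xs ≤ I.mean (phaseAlgorithm d O.ask i h) +
        3 * confRadius i h (phaseAlgorithm d O.ask i h) := by
    intro h hrun hdev
    have hroom : HasRoom (k := k) d i h (pools d O.ask i h m) := by
      have := countP_pool_le O hi hδ1 (hnet xs) hrun m hM hρ
        (hc (rho d i / 2) (by positivity) (by linarith))
      unfold HasRoom
      linarith
    exact mean_le_phaseAlgorithm hdiam O hi hne hrun hdev hroom hxs
  refine (sum_gap_le_radiusSum hstep hrun).trans ?_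
  have hrad := radiusSum_le i h hρ
  have hcard := card_played_le hd0 hi hne hrun
  set W : ℝ := ((h.map Prod.fst).toFinset.card : ℝ)
  set B : ℝ := ((2 : ℝ) ^ i) ^ (d / (d + 2)) with hB
  set G : ℝ := ((2 : ℝ) ^ i) ^ (1 - 1 / (d + 2)) with hG
  have hB0 : 0 < B := by positivity
  have hlen' : (h.length : ℝ) ≤ 2 ^ i := by exact_mod_cast hlen
  have h1 : (h.length : ℝ) * rho d i ^ 2 ≤ B := by
    rw [hB, ← two_pow_mul_rho_sq hd0]; gcongr
  have h2 : (netSize d i : ℝ) ≤ B := by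
    refine (Nat.floor_le (by positivity)).trans ?_
    linarith
  have h3 : quota d k i ≤ B := quota_le hd0 k hid
  have hW : W ≤ (k + 3) * B := by
    have : ((k : ℝ) + 1) * quota d k i ≤ (k + 1) * B := by gcongr
    linarith
  have h4 : (h.length : ℝ) * rho d i ≤ G := by
    rw [hG, ← two_pow_mul_rho d]; gcongr
  -- The exponents match: `T ^ (d / (d + 2)) / ρ = T ρ = T ^ γ`.
  have h5 : B * (1 / rho d i) = G := by
    rw [hB, hG, ← two_pow_mul_rho_sq hd0, ← two_pow_mul_rho d]
    field_simp
  have hG0 : 0 < G := by positivity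
  have h6 : W * (8 * i / rho d i) ≤ 8 * i * (k + 3) * G := by
    calc W * (8 * i / rho d i) ≤ (k + 3) * B * (8 * i / rho d i) := by gcongr
      _ = 8 * i * (k + 3) * (B * (1 / rho d i)) := by ring
      _ = _ := by rw [h5]
  have h7 : 0 ≤ (k : ℝ) * G := by positivity
  calc 3 * radiusSum i h ≤ 3 * (G + 8 * i * (k + 3) * G) := by linarith
    _ ≤ _ := by linarith

end PhaseRegret

/-! ### The regret dimension -/

section RegretDim

variable {X : Type*} [MetricSpace X] [Nonempty X] {k : ℕ} {dstar : ℝ}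

/-- Phase `i` starts after `2 ^ i - 2` rounds, and in it the algorithm only looks at the rounds of
this phase. -/
theorem quotaZooming_eq_phaseAlgorithm {X : Type*} [Nonempty X] (d : ℝ)
    (ask : Fin (k + 1) → List (X × ℝ) → Option X) {i : ℕ} (hi : 1 ≤ i) (ω : X × ℕ → ℝ) {s : ℕ}
    (hs : s < 2 ^ i) :
    quotaZooming d ask (history (quotaZooming d ask) ω (2 ^ i - 2 + s)) =
      phaseAlgorithm d ask i (recentHistory (quotaZooming d ask) ω (2 ^ i - 2) s) := by
  have h2 : 2 ≤ 2 ^ i := le_self_pow₀ (by norm_num) (by omega)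
  have hlen : 2 ^ i - 2 + s + 2 = 2 ^ i + s := by omega
  have hlog : Nat.log 2 (2 ^ i + s) = i := by
    refine Nat.log_eq_of_pow_le_of_lt_pow (by omega) ?_
    rw [pow_succ]
    omega
  conv_lhs => rw [quotaZooming]
  rw [length_history, hlen, hlog, Nat.add_sub_cancel_left, recentHistory]

theorem cleanRun_recentHistory (d : ℝ) (ask : Fin (k + 1) → List (X × ℝ) → Option X)
    (I : BanditInstance X) {i : ℕ} (hi : 1 ≤ i) (ω : X × ℕ → ℝ)
    (hω : ∀ s ≤ 2 ^ i, ¬ Deviates I i (recentHistory (quotaZooming d ask) ω (2 ^ i - 2) s))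
    {s : ℕ} (hs : s ≤ 2 ^ i) :
    CleanRun I d ask i (recentHistory (quotaZooming d ask) ω (2 ^ i - 2) s) := by
  induction s with
  | zero => simp [recentHistory, CleanRun]
  | succ s ih =>
    rw [recentHistory_succ]
    exact ⟨ih (by omega), hω s (by omega), quotaZooming_eq_phaseAlgorithm d ask hi ω (by omega)⟩

theorem sum_recentHistory {X : Type*} (A : BanditAlgorithm X) (ω : X × ℕ → ℝ) (t₀ s : ℕ)
    (g : X → ℝ) :
    ((recentHistory A ω t₀ s).map fun p => g p.1).sum =
      ∑ j ∈ Finset.range s, g (A (history A ω (t₀ + j))) := by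
  induction s with
  | zero => simp [recentHistory]
  | succ s ih =>
    rw [recentHistory_succ, Finset.sum_range_succ, ← ih, List.map_cons, List.sum_cons, add_comm]

/-- The expected regret of a long phase. Large deviations contribute a bounded amount. -/
theorem eventually_integral_phase_le [CompactSpace X] (hdiam : ∀ x y : X, dist x y ≤ 1)
    {D : FatDecomposition X dstar k} {d : ℝ} (hd : dstar < d) (O : CoveringOracle D)
    (I : BanditInstance X) :
    ∃ xs : X, (∀ x, I.mean x ≤ I.mean xs) ∧ ∀ᶠ i : ℕ in Filter.atTop,
      ∑ s ∈ Finset.range (2 ^ i), ∫ ω, (I.mean xs - I.mean (quotaZooming d O.ask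
        (history (quotaZooming d O.ask) ω (2 ^ i - 2 + s)))) ∂I.law ≤
          24 * (k + 3) * (i + 1) * ((2 : ℝ) ^ i) ^ (1 - 1 / (d + 2)) + 4 := by
  obtain ⟨xs, hmax, hev⟩ := eventually_sum_gap_le hdiam hd O I
  refine ⟨xs, hmax, ?_⟩
  filter_upwards [hev, Filter.eventually_ge_atTop 1] with i hclean hi
  have hA := measurableAlgorithm_quotaZooming d O.ask
  set A := quotaZooming d O.ask
  set B := 24 * (k + 3) * (i + 1) * ((2 : ℝ) ^ i) ^ (1 - 1 / (d + 2)) with hB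
  have hd0 : 0 < d := (D.dim_nonneg I).trans_lt hd
  have hB0 : 0 ≤ B := by positivity
  -- A measurable hull, which avoids any discussion of the measurability of the event itself.
  set bad : Set (X × ℕ → ℝ) := toMeasurable I.law
    {ω | ∃ s ≤ 2 ^ i, Deviates I i (recentHistory A ω (2 ^ i - 2) s)} with hbad
  have hbadm : MeasurableSet bad := measurableSet_toMeasurable _ _
  have hprob : I.law.real bad ≤ 4 / 2 ^ i := by
    rw [measureReal_def, hbad, measure_toMeasurable]
    exact ENNReal.toReal_le_of_le_ofReal (by positivity)
      (law_exists_deviates_le I hA hi (2 ^ i - 2))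
  have hint : ∀ s, Integrable (fun ω => I.mean xs - I.mean (A (history A ω (2 ^ i - 2 + s))))
      I.law := fun s => hA.integrable_play I _ fun x => I.mean xs - I.mean x
  have hpoint : ∀ ω, ∑ s ∈ Finset.range (2 ^ i),
      (I.mean xs - I.mean (A (history A ω (2 ^ i - 2 + s)))) ≤
        B + bad.indicator (fun _ => (2 : ℝ) ^ i) ω := by
    intro ω
    by_cases hω : ω ∈ bad
    · rw [indicator_of_mem hω]
      calc _ ≤ ∑ s ∈ Finset.range (2 ^ i), (1 : ℝ) := by
            refine Finset.sum_le_sum fun s _ => ?_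
            have h1 := (I.mean_mem_Icc xs).2
            have h2 := (I.mean_mem_Icc (A (history A ω (2 ^ i - 2 + s)))).1
            linarith
        _ = (2 : ℝ) ^ i := by simp
        _ ≤ _ := by linarith
    · rw [indicator_of_notMem hω, add_zero,
        ← sum_recentHistory A ω (2 ^ i - 2) (2 ^ i) fun x => I.mean xs - I.mean x]
      have hω' : ∀ s ≤ 2 ^ i, ¬ Deviates I i (recentHistory A ω (2 ^ i - 2) s) :=
        fun s hs hdev => hω (subset_toMeasurable _ _ ⟨s, hs, hdev⟩)
      refine hclean _ (cleanRun_recentHistory d O.ask I hi ω hω' le_rfl) ?_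
      simp [recentHistory]
  rw [← integral_finsetSum _ fun s _ => hint s]
  calc _ ≤ ∫ ω, (B + bad.indicator (fun _ => (2 : ℝ) ^ i) ω) ∂I.law :=
        integral_mono (integrable_finsetSum _ fun s _ => hint s)
          ((integrable_const B).add ((integrable_const _).indicator hbadm)) hpoint
    _ = B + I.law.real bad * 2 ^ i := by
        rw [integral_add (integrable_const B) ((integrable_const _).indicator hbadm),
          integral_indicator_const _ hbadm]
        simp
    _ ≤ B + 4 := by
        gcongr
        calc _ ≤ 4 / 2 ^ i * (2 : ℝ) ^ i := by gcongr
          _ = 4 := by field_simp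

/-- Phases of geometrically increasing length: if phase `i` contributes at most
`C (i + 1) 2 ^ (i γ)`, then all phases up to `m` contribute at most `C (m + 1)² 2 ^ (m γ)`. -/
theorem sum_phases_le {a : ℕ → ℝ} {C γ : ℝ} (hC : 0 ≤ C) (hγ : 0 ≤ γ)
    (ha : ∀ i : ℕ, 1 ≤ i → ∑ s ∈ Finset.range (2 ^ i), a (2 ^ i - 2 + s) ≤
      C * (i + 1) * ((2 : ℝ) ^ i) ^ γ) (m : ℕ) :
    ∑ s ∈ Finset.range (2 ^ (m + 1) - 2), a s ≤ C * (m + 1) ^ 2 * ((2 : ℝ) ^ m) ^ γ := by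
  induction m with
  | zero => simpa using hC
  | succ m ih =>
    have h2 : 2 ≤ 2 ^ (m + 1) := le_self_pow₀ (by norm_num) (by omega)
    have hsplit : 2 ^ (m + 1 + 1) - 2 = (2 ^ (m + 1) - 2) + 2 ^ (m + 1) := by
      rw [pow_succ 2 (m + 1)]; omega
    rw [hsplit, Finset.sum_range_add]
    have h1 := ha (m + 1) (by omega)
    push_cast at h1 ⊢
    set G := ((2 : ℝ) ^ (m + 1)) ^ γ with hG
    have hG0 : 0 < G := by positivity
    have hmono : ((2 : ℝ) ^ m) ^ γ ≤ G := by
      rw [hG]; gcongr <;> norm_num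
    have h3 : C * ((m : ℝ) + 1) ^ 2 * ((2 : ℝ) ^ m) ^ γ ≤ C * (m + 1) ^ 2 * G := by gcongr
    have h4 : 0 ≤ C * G * (m + 1) := by positivity
    calc _ ≤ C * ((m : ℝ) + 1) ^ 2 * G + C * (m + 1 + 1) * G := add_le_add (ih.trans h3) h1
      _ ≤ C * ((m : ℝ) + 1 + 1) ^ 2 * G := by linarith

/-- Squared logarithms are absorbed by any increase of the exponent. -/
theorem eventually_log_sq_mul_rpow_le (C : ℝ) {γ γ' : ℝ} (hγ0 : 0 ≤ γ) (hγ1 : γ ≤ 1)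
    (hγγ : γ < γ') (hC : 0 ≤ C) :
    ∀ᶠ t : ℕ in Filter.atTop,
      C * ((Nat.log 2 (t + 2) : ℝ) + 1) ^ 2 * ((t : ℝ) + 2) ^ γ ≤ (t : ℝ) ^ γ' := by
  have hlog2 : 0 < Real.log 2 := Real.log_pos (by norm_num)
  set η : ℝ := Real.log 2 ^ 2 / (18 * (C + 1)) with hη
  have hη0 : 0 < η := by positivity
  have hlo := ((isLittleO_log_rpow_atTop (half_pos (sub_pos.2 hγγ))).def
    (Real.sqrt_pos.2 hη0)).natCast_atTop
  filter_upwards [hlo, Filter.eventually_ge_atTop 2] with t ht ht2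
  have ht2' : (2 : ℝ) ≤ t := by exact_mod_cast ht2
  have ht0 : (0 : ℝ) < t := by linarith
  have hlogt : 0 < Real.log t := Real.log_pos (by linarith)
  rw [Real.norm_of_nonneg hlogt.le, Real.norm_of_nonneg (by positivity)] at ht
  have hsq : Real.log t ^ 2 ≤ η * (t : ℝ) ^ (γ' - γ) := by
    calc Real.log t ^ 2 ≤ (√η * (t : ℝ) ^ ((γ' - γ) / 2)) ^ 2 := by gcongr
      _ = η * (t : ℝ) ^ (γ' - γ) := by
        rw [mul_pow, Real.sq_sqrt hη0.le, ← Real.rpow_natCast (_ ^ (_ : ℝ)) 2,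
          ← Real.rpow_mul ht0.le]
        congr 2
        push_cast
        ring
  have hnat : (Nat.log 2 (t + 2) : ℝ) * Real.log 2 ≤ 2 * Real.log t := by
    have h1 : ((2 : ℝ)) ^ Nat.log 2 (t + 2) ≤ (t : ℝ) ^ 2 := by
      have : 2 ^ Nat.log 2 (t + 2) ≤ t + 2 := Nat.pow_log_le_self 2 (by omega)
      have h' : (2 : ℝ) ^ Nat.log 2 (t + 2) ≤ t + 2 := by exact_mod_cast this
      nlinarith
    have h2 := Real.log_le_log (by positivity) h1
    rwa [Real.log_pow, Real.log_pow] at h2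
  have hm : ((Nat.log 2 (t + 2) : ℝ) + 1) * Real.log 2 ≤ 3 * Real.log t := by
    have := Real.log_le_log (by norm_num) ht2'
    linarith
  have hm2 : ((Nat.log 2 (t + 2) : ℝ) + 1) ^ 2 * Real.log 2 ^ 2 ≤ 9 * Real.log t ^ 2 := by
    calc _ = (((Nat.log 2 (t + 2) : ℝ) + 1) * Real.log 2) ^ 2 := by ring
      _ ≤ (3 * Real.log t) ^ 2 := by gcongr
      _ = _ := by ring
  have hpow : ((t : ℝ) + 2) ^ γ ≤ 2 * (t : ℝ) ^ γ := by
    calc ((t : ℝ) + 2) ^ γ ≤ (2 * t) ^ γ := by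
          apply Real.rpow_le_rpow (by positivity) (by linarith) hγ0
      _ = 2 ^ γ * (t : ℝ) ^ γ := Real.mul_rpow (by norm_num) ht0.le
      _ ≤ 2 ^ (1 : ℝ) * (t : ℝ) ^ γ := by
        gcongr
        norm_num
      _ = _ := by rw [Real.rpow_one]
  have hm3 : C * ((Nat.log 2 (t + 2) : ℝ) + 1) ^ 2 * 2 ≤ (t : ℝ) ^ (γ' - γ) := by
    have h1 : ((Nat.log 2 (t + 2) : ℝ) + 1) ^ 2 * Real.log 2 ^ 2 ≤
        9 * (η * (t : ℝ) ^ (γ' - γ)) := hm2.trans (by gcongr)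
    have h2 : 9 * (η * (t : ℝ) ^ (γ' - γ)) * (2 * (C + 1)) =
        (t : ℝ) ^ (γ' - γ) * Real.log 2 ^ 2 := by
      rw [hη]; field_simp; ring
    have h3 : ((Nat.log 2 (t + 2) : ℝ) + 1) ^ 2 * (2 * (C + 1)) ≤ (t : ℝ) ^ (γ' - γ) := by
      refine le_of_mul_le_mul_right ?_ (by positivity : 0 < Real.log 2 ^ 2)
      rw [← h2]
      calc _ = ((Nat.log 2 (t + 2) : ℝ) + 1) ^ 2 * Real.log 2 ^ 2 * (2 * (C + 1)) := by ring
        _ ≤ _ := by gcongr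
    have h4 : 0 ≤ ((Nat.log 2 (t + 2) : ℝ) + 1) ^ 2 := by positivity
    linarith
  calc _ ≤ C * ((Nat.log 2 (t + 2) : ℝ) + 1) ^ 2 * (2 * (t : ℝ) ^ γ) := by gcongr
    _ = C * ((Nat.log 2 (t + 2) : ℝ) + 1) ^ 2 * 2 * (t : ℝ) ^ γ := by ring
    _ ≤ (t : ℝ) ^ (γ' - γ) * (t : ℝ) ^ γ := by gcongr
    _ = (t : ℝ) ^ γ' := by rw [← Real.rpow_add ht0]; congr 1; ring

/-- After `t` rounds the regret is at most of order `(log t)² t ^ (1 - 1 / (d + 2))`. -/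
theorem exists_regret_le [CompactSpace X] (hdiam : ∀ x y : X, dist x y ≤ 1)
    {D : FatDecomposition X dstar k} {d : ℝ} (hd : dstar < d) (O : CoveringOracle D)
    (I : BanditInstance X) :
    ∃ C : ℝ, 0 ≤ C ∧ ∀ t : ℕ, regret (quotaZooming d O.ask) I t ≤
      C * ((Nat.log 2 (t + 2) : ℝ) + 1) ^ 2 * ((t : ℝ) + 2) ^ (1 - 1 / (d + 2)) := by
  have hd0 : 0 < d := (D.dim_nonneg I).trans_lt hd
  obtain ⟨xs, hmax, hev⟩ := eventually_integral_phase_le hdiam hd O I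
  obtain ⟨i₀, hi₀⟩ := Filter.eventually_atTop.1 hev
  have hA := measurableAlgorithm_quotaZooming d O.ask
  set A := quotaZooming d O.ask
  set γ := 1 - 1 / (d + 2) with hγ
  have hγ0 : 0 ≤ γ := by
    rw [hγ, sub_nonneg, div_le_one (by linarith)]; linarith
  have hsup : (⨆ x, I.mean x) = I.mean xs :=
    le_antisymm (ciSup_le hmax) (le_ciSup ⟨I.mean xs, by rintro _ ⟨x, rfl⟩; exact hmax x⟩ xs)
  set a : ℕ → ℝ := fun s => ∫ ω, (I.mean xs - I.mean (A (history A ω s))) ∂I.law with ha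
  have ha0 : ∀ s, 0 ≤ a s := fun s => integral_nonneg fun ω => sub_nonneg.2 (hmax _)
  -- The trivial bound takes care of the finitely many short phases.
  have ha1 : ∀ s, a s ≤ 1 := by
    intro s
    have h := integral_mono (hA.integrable_play I s fun x => I.mean xs - I.mean x)
      (integrable_const (1 : ℝ)) (fun ω => by
        have h1 := (I.mean_mem_Icc xs).2
        have h2 := (I.mean_mem_Icc (A (history A ω s))).1
        change I.mean xs - I.mean (A (history A ω s)) ≤ 1
        linarith)
    simpa using h
  set C : ℝ := 24 * (k + 3) + 4 + 2 ^ i₀ with hC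
  have hC0 : 0 ≤ C := by positivity
  have hphase : ∀ i : ℕ, 1 ≤ i → ∑ s ∈ Finset.range (2 ^ i), a (2 ^ i - 2 + s) ≤
      C * (i + 1) * ((2 : ℝ) ^ i) ^ γ := by
    intro i _
    have hG : 1 ≤ ((2 : ℝ) ^ i) ^ γ := Real.one_le_rpow (one_le_pow₀ (by norm_num)) hγ0
    have hi : (1 : ℝ) ≤ i + 1 := by linarith [i.cast_nonneg (α := ℝ)]
    have hiG : 1 ≤ ((i : ℝ) + 1) * ((2 : ℝ) ^ i) ^ γ := one_le_mul_of_one_le_of_one_le hi hG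
    have h2i : (0 : ℝ) < 2 ^ i₀ := by positivity
    rcases le_total i₀ i with h | h
    · refine (hi₀ i h).trans ?_
      have := mul_nonneg h2i.le (zero_le_one.trans hiG)
      rw [hC]
      linarith
    · calc _ ≤ ∑ s ∈ Finset.range (2 ^ i), (1 : ℝ) := Finset.sum_le_sum fun s _ => ha1 _
        _ = (2 : ℝ) ^ i := by simp
        _ ≤ 2 ^ i₀ := pow_le_pow_right₀ (by norm_num) h
        _ ≤ C := by rw [hC]; have := k.cast_nonneg (α := ℝ); linarith
        _ ≤ C * (((i : ℝ) + 1) * ((2 : ℝ) ^ i) ^ γ) := le_mul_of_one_le_right hC0 hiG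
        _ = _ := by ring
  refine ⟨C, hC0, fun t => ?_⟩
  rw [hA.regret_eq_sum, hsup]
  have hlt : t + 2 < 2 ^ (Nat.log 2 (t + 2) + 1) := Nat.lt_pow_succ_log_self (by norm_num) _
  have hle : (2 : ℝ) ^ Nat.log 2 (t + 2) ≤ (t : ℝ) + 2 := by
    exact_mod_cast Nat.pow_log_le_self 2 (by omega : t + 2 ≠ 0)
  calc ∑ s ∈ Finset.range t, a s
      ≤ ∑ s ∈ Finset.range (2 ^ (Nat.log 2 (t + 2) + 1) - 2), a s :=
        Finset.sum_le_sum_of_subset_of_nonneg (Finset.range_subset_range.2 (by omega))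
          fun s _ _ => ha0 s
    _ ≤ C * ((Nat.log 2 (t + 2) : ℝ) + 1) ^ 2 * ((2 : ℝ) ^ Nat.log 2 (t + 2)) ^ γ :=
        sum_phases_le hC0 hγ0 hphase _
    _ ≤ _ := by gcongr

end RegretDim

end LipschitzMAB

theorem mainTheorem4 {X : Type*} [MetricSpace X] [CompactSpace X] [Nonempty X]
    (hdiam : ∀ x y : X, dist x y ≤ 1)
    {k : ℕ} {dstar : ℝ} (D : LipschitzMAB.FatDecomposition X dstar k)
    (d : ℝ) (hd : dstar < d) (O : LipschitzMAB.CoveringOracle D) :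
    (∀ (I : LipschitzMAB.BanditInstance X) (t : ℕ), MeasureTheory.Integrable
      (LipschitzMAB.totalPayoff (LipschitzMAB.quotaZooming d O.ask) t) I.law) ∧
    LipschitzMAB.regretDim (LipschitzMAB.quotaZooming d O.ask) ≤ (d : EReal) := by
  refine ⟨fun I t =>
    (LipschitzMAB.measurableAlgorithm_quotaZooming d O.ask).integrable_totalPayoff I t,
    iSup_le fun I => ?_⟩
  have hd0 : 0 < d := (D.dim_nonneg I).trans_lt hd
  obtain ⟨C, hC, hregret⟩ := LipschitzMAB.exists_regret_le hdiam hd O I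
  -- The logarithms are absorbed by passing to an arbitrary dimension `d' > d`.
  refine EReal.le_of_forall_lt_iff_le.1 fun d' hd' => ?_
  have hd' : d < d' := by exact_mod_cast hd'
  refine sInf_le ⟨d', ⟨by linarith, ?_⟩, rfl⟩
  have hγ : 1 - 1 / (d + 2) < 1 - 1 / (d' + 2) := by
    have := one_div_lt_one_div_of_lt (by linarith : 0 < d + 2) (by linarith : d + 2 < d' + 2)
    linarith
  have h0 : 0 ≤ 1 - 1 / (d + 2) := by
    rw [sub_nonneg, div_le_one (by linarith)]; linarith
  have h1 : 1 - 1 / (d + 2) ≤ 1 := by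
    have : 0 < 1 / (d + 2) := by positivity
    linarith
  obtain ⟨t₀, ht₀⟩ := Filter.eventually_atTop.1
    (LipschitzMAB.eventually_log_sq_mul_rpow_le C h0 h1 hγ hC)
  exact ⟨t₀, fun t ht => (hregret t).trans (ht₀ t ht)⟩
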